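/- Let $e_1,e_2$ be the canonical basis of $\mathbb R^2$ and set $d_1=\sqrt3\,e_1$, $d_2=\frac{\sqrt3}{2}e_1+\frac32 e_2$, $p=\frac{\sqrt3}{2}e_1+\frac12e_2$, $p_1=d_1-p$, $p_2=d_2-p$, $p_3=-p$ (indices of $p_i$ are taken modulo $3$). For $\ell>0$ let $$L_1(\ell)=\{n^1\ell d_1+n^2\ell d_2:\ (n^1,n^2)\in\mathbb Z^2\},\qquad L_2(\ell)=\ell p+L_1(\ell)$$ be the two Bravais lattices whose union is the hexagonal $2$-lattice. For a lattice point $x$ let $T^\ell(x)$ be the open equilateral triangle of side $\sqrt3\,\ell$ centred at $x$ with vertices $x+\ell p_i$ ($i=1,2,3$) if $x\in L_1(\ell)$, and $x-\ell p_i$ ($i=1,2,3$) if $x\in L_2(\ell)$; these triangles are the cells of the dual triangulation of $\mathbb R^2$. For $\Omega\subset\mathbb R^2$ let $$\mathcal A_\ell=\{w\in L^2(\mathbb R^2):\ w\text{ is constant over each }T^\ell(x),\ \ w=0\text{ over all }T^\ell(x)\nsubseteq\Omega\},$$ where $w(x)$ at a lattice point $x$ denotes the constant value of $w$ on $T^\ell(x)$.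 For $w\in\mathcal A_\ell$ the bending energy is $\mathcal U_\ell(w)=\mathcal U^{\mathcal Z}_\ell(w)+\mathcal U^{\mathcal C}_\ell(w)+\mathcal U^{s}_\ell(w)$ with $$\mathcal U^{\mathcal Z}_\ell(w)=\tfrac12k^{\mathcal Z}\sum_{x\in L_2(\ell)}\sum_{i=1}^3\Big[\Theta^{\mathcal Z}_{i,i+1}(x)^2+\Theta^{\mathcal Z}_{i,i+2}(x)^2\Big],\qquad \mathcal U^{\mathcal C}_\ell(w)=\tfrac12k^{\mathcal C}\sum_{x\in L_2(\ell)}\sum_{i=1}^3\Big[\Theta^{\mathcal C}_{i+}(x)^2+\Theta^{\mathcal C}_{i-}(x)^2\Big],$$ $$\mathcal U^{s}_\ell(w)=-\tfrac12\tau_0\Big[\sum_{x\in L_1(\ell)}\Theta^{s}_1(x)^2+\sum_{x\in L_2(\ell)}\Theta^{s}_2(x)^2\Big],$$ where $$\Theta^{\mathcal Z}_{i,j}(x)=\tfrac{2\sqrt3}{3\ell}\big[w(x+\ell p_i-\ell p_j)-w(x+\ell p_i)+w(x+\ell p_j)-w(x)\big],$$ $$\Theta^{\mathcal C}_{i+}(x)=\tfrac{2\sqrt3}{3\ell}\big[2w(x)-w(x+\ell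 p_{i+1})+w(x+\ell p_i-\ell p_{i+2})-2w(x+\ell p_i)\big],$$ $$\Theta^{\mathcal C}_{i-}(x)=-\tfrac{2\sqrt3}{3\ell}\big[2w(x)-w(x+\ell p_{i+2})+w(x+\ell p_i-\ell p_{i+1})-2w(x+\ell p_i)\big],$$ $$\Theta^{s}_1(x)=\tfrac{\sqrt{3\sqrt3}}{\ell}\Big(\tfrac13\sum_{i=1}^3w(x-\ell p_i)-w(x)\Big),\qquad \Theta^{s}_2(x)=\tfrac{\sqrt{3\sqrt3}}{\ell}\Big(\tfrac13\sum_{i=1}^3w(x+\ell p_i)-w(x)\Big).$$ **Theorem.** Let $\Omega\subset\mathbb R^2$ be open, bounded and simply connected, and let $k^{\mathcal Z}>0$, $k^{\mathcal C}\ge0$, $\tau_0\le0$. Let $\ell\to0^+$ along a sequence and let $w_\ell\in\mathcal A_\ell$ satisfy $$\sup_\ell\,\mathcal U_\ell(w_\ell)<+\infty .$$ Then there exist a function $w\in H^2(\mathbb R^2)$ with $w=0$ almost everywhere outside $\Omega$ and a subsequence of $(w_\ell)$, not relabelled, such that $$w_\ell\to w\quad\text{strongly in }L^2(\Omega).$$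 Moreover, if $\Omega$ has the segment property (every point of $\partial\Omega$ has a neighbourhood $V$ and a vector $y\neq0$ such that $z+ty\in\Omega$ for all $z\in\overline\Omega\cap V$ and $0<t<1$; every bounded open set with Lipschitz boundary has it), then $w\in H^2_0(\Omega)$, the closure of $C_c^\infty(\Omega)$ in $H^2(\Omega)$. -/

import Mathlib

open MeasureTheory Filter Topology
open scoped ContDiff

noncomputable section

namespace Graphene

/-- The Euclidean plane. -/
abbrev Plane : Type := EuclideanSpace ℝ (Fin 2)

/-! ### The hexagonal 2-lattice -/

/-- The lattice vector `d₁ = √3 e₁`. -/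
def d₁ : Plane := !₂[√3, 0]

/-- The lattice vector `d₂ = (√3 / 2) e₁ + (3 / 2) e₂`. -/
def d₂ : Plane := !₂[√3 / 2, 3 / 2]

/-- The shift vector `p = (√3 / 2) e₁ + (1 / 2) e₂`. -/
def shift : Plane := !₂[√3 / 2, 1 / 2]

/-- The bond vectors `p₁ = d₁ - p`, `p₂ = d₂ - p`, `p₃ = -p`, written `p 0`, `p 1`, `p 2`; the
addition of `Fin 3` is the cyclic addition of indices. -/
def p : Fin 3 → Plane := ![d₁ - shift, d₂ - shift, -shift]

/-- The lattice point `n₁ ℓ d₁ + n₂ ℓ d₂ + m ℓ p`. The points with `m = 0` form the Bravais lattice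
`L₁(ℓ)`, those with `m = 1` form `L₂(ℓ)`; for `ℓ ≠ 0` the labelling is injective. -/
def node (ℓ : ℝ) (m : Fin 2) (n : ℤ × ℤ) : Plane :=
  ((n.1 : ℝ) * ℓ) • d₁ + ((n.2 : ℝ) * ℓ) • d₂ + (((m : ℕ) : ℝ) * ℓ) • shift

/-- The open triangle of the dual triangulation centred at a lattice point `x`: the equilateral
triangle of side `√3 ℓ` whose vertices are `x + ℓ pᵢ` if `x ∈ L₁(ℓ)`, and `x - ℓ pᵢ` if
`x ∈ L₂(ℓ)`. These triangles are the cells of the triangulation dual to the hexagonal lattice. -/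
def triangle (ℓ : ℝ) (m : Fin 2) (n : ℤ × ℤ) : Set Plane :=
  interior (convexHull ℝ
    (Set.range fun i : Fin 3 => node ℓ m n + (if m = 0 then ℓ else -ℓ) • p i))

/-- The admissible displacements: functions in `L²(ℝ²)` that are constant over each triangle of the
dual triangulation and vanish over all the triangles that are not contained in `Ω`. -/
def Admissible (Ω : Set Plane) (ℓ : ℝ) : Set (Plane → ℝ) :=
  {w | MemLp w 2 volume ∧
    (∀ m n, ∀ x ∈ triangle ℓ m n, w x = w (node ℓ m n)) ∧
    (∀ m n, ¬ triangle ℓ m n ⊆ Ω → ∀ x ∈ triangle ℓ m n, w x = 0)}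

/-! ### The bending energy -/

/-- The change of the Z-dihedral angle with middle edge `ℓ pᵢ` starting at `x` and the two other
edges parallel to `pⱼ`. -/
def thetaZ (ℓ : ℝ) (w : Plane → ℝ) (i j : Fin 3) (x : Plane) : ℝ :=
  2 * √3 / (3 * ℓ) *
    (w (x + ℓ • p i - ℓ • p j) - w (x + ℓ • p i) + w (x + ℓ • p j) - w x)

/-- The change of the C-dihedral angle with middle edge `ℓ pᵢ` starting at `x`, oriented as
`pᵢ` rotated by `π / 2` counter-clockwise. -/
def thetaCPlus (ℓ : ℝ) (w : Plane → ℝ) (i : Fin 3) (x : Plane) : ℝ :=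
  2 * √3 / (3 * ℓ) *
    (2 * w x - w (x + ℓ • p (i + 1)) + w (x + ℓ • p i - ℓ • p (i + 2)) - 2 * w (x + ℓ • p i))

/-- The change of the C-dihedral angle with middle edge `ℓ pᵢ` starting at `x`, with the opposite
orientation. -/
def thetaCMinus (ℓ : ℝ) (w : Plane → ℝ) (i : Fin 3) (x : Plane) : ℝ :=
  -(2 * √3 / (3 * ℓ) *
    (2 * w x - w (x + ℓ • p (i + 2)) + w (x + ℓ • p i - ℓ • p (i + 1)) - 2 * w (x + ℓ • p i)))

/-- The strain measure of the self-energy at the points of `L₁(ℓ)`. -/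
def thetaS₁ (ℓ : ℝ) (w : Plane → ℝ) (x : Plane) : ℝ :=
  √(3 * √3) / ℓ * (1 / 3 * ∑ i : Fin 3, w (x - ℓ • p i) - w x)

/-- The strain measure of the self-energy at the points of `L₂(ℓ)`. -/
def thetaS₂ (ℓ : ℝ) (w : Plane → ℝ) (x : Plane) : ℝ :=
  √(3 * √3) / ℓ * (1 / 3 * ∑ i : Fin 3, w (x + ℓ • p i) - w x)

/-- The Z-dihedral energy. For admissible `w` and bounded `Ω` this sum and the two below have
finitely many nonzero terms. -/
def energyZ (kZ ℓ : ℝ) (w : Plane → ℝ) : ℝ :=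
  1 / 2 * kZ * ∑' n : ℤ × ℤ, ∑ i : Fin 3,
    (thetaZ ℓ w i (i + 1) (node ℓ 1 n) ^ 2 + thetaZ ℓ w i (i + 2) (node ℓ 1 n) ^ 2)

/-- The C-dihedral energy. -/
def energyC (kC ℓ : ℝ) (w : Plane → ℝ) : ℝ :=
  1 / 2 * kC * ∑' n : ℤ × ℤ, ∑ i : Fin 3,
    (thetaCPlus ℓ w i (node ℓ 1 n) ^ 2 + thetaCMinus ℓ w i (node ℓ 1 n) ^ 2)

/-- The self-energy. -/
def energyS (τ₀ ℓ : ℝ) (w : Plane → ℝ) : ℝ :=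
  -(1 / 2) * τ₀ *
    ((∑' n : ℤ × ℤ, thetaS₁ ℓ w (node ℓ 0 n) ^ 2) + ∑' n : ℤ × ℤ, thetaS₂ ℓ w (node ℓ 1 n) ^ 2)

/-- The total bending energy. -/
def energy (kZ kC τ₀ ℓ : ℝ) (w : Plane → ℝ) : ℝ :=
  energyZ kZ ℓ w + energyC kC ℓ w + energyS τ₀ ℓ w

/-! ### Sobolev spaces -/

/-- The classical partial derivative `∂ᵢ φ`. -/
def partialD (i : Fin 2) (φ : Plane → ℝ) (x : Plane) : ℝ :=
  fderiv ℝ φ x (EuclideanSpace.single i 1)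

/-- `φ ∈ C_c^∞(U)`. -/
def IsTest (U : Set Plane) (φ : Plane → ℝ) : Prop :=
  ContDiff ℝ ∞ φ ∧ HasCompactSupport φ ∧ tsupport φ ⊆ U

/-- `g` is the weak partial derivative `∂ᵢ u` in `U`. -/
def IsWeakPartial (U : Set Plane) (i : Fin 2) (u g : Plane → ℝ) : Prop :=
  ∀ φ, IsTest U φ → ∫ x in U, u x * partialD i φ x = -∫ x in U, g x * φ x

/-- `u ∈ H²(U)`, with first weak partial derivatives `∂ᵢ u = g i` and second ones
`∂ⱼ ∂ᵢ u = h i j`. -/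
def IsH2 (U : Set Plane) (u : Plane → ℝ) (g : Fin 2 → Plane → ℝ)
    (h : Fin 2 → Fin 2 → Plane → ℝ) : Prop :=
  MemLp u 2 (volume.restrict U) ∧
  (∀ i, MemLp (g i) 2 (volume.restrict U) ∧ IsWeakPartial U i u (g i)) ∧
  (∀ i j, MemLp (h i j) 2 (volume.restrict U) ∧ IsWeakPartial U j (g i) (h i j))

/-- `u ∈ H²(U)`. -/
def MemH2 (U : Set Plane) (u : Plane → ℝ) : Prop := ∃ g h, IsH2 U u g h

/-- `u ∈ H²₀(U)`: the closure of `C_c^∞(U)` in `H²(U)`. -/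
def MemH20 (U : Set Plane) (u : Plane → ℝ) : Prop :=
  ∃ g h, IsH2 U u g h ∧ ∃ φ : ℕ → Plane → ℝ, (∀ k, IsTest U (φ k)) ∧
    Tendsto (fun k => eLpNorm (φ k - u) 2 (volume.restrict U)) atTop (𝓝 0) ∧
    (∀ i, Tendsto (fun k => eLpNorm (partialD i (φ k) - g i) 2 (volume.restrict U))
      atTop (𝓝 0)) ∧
    (∀ i j, Tendsto (fun k => eLpNorm (partialD j (partialD i (φ k)) - h i j) 2
      (volume.restrict U)) atTop (𝓝 0))

/-- The segment property of an open set (every bounded open set with Lipschitz, or merely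
continuous, boundary has it): near each boundary point, short translations of the closure in one
fixed direction lead into the set. -/
def SegmentProperty (U : Set Plane) : Prop :=
  ∀ x ∈ frontier U, ∃ V ∈ 𝓝 x, ∃ y : Plane, y ≠ 0 ∧
    ∀ z ∈ closure U ∩ V, ∀ t : ℝ, 0 < t → t < 1 → z + t • y ∈ U

end Graphene

end

/-!
The Z-dihedral energy alone gives the compactness: the two other energies are nonnegative and are
dropped. Let `u` and `v` be the values of a displacement over the Bravais lattices `L₁(ℓ)` and
`L₂(ℓ)`, as functions on `ℤ²`. Two algebraic facts carry the discrete part. The sum of the two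
Z-dihedral angles with edges `pᵢ, pⱼ` and `pⱼ, pᵢ`, at suitably shifted base points, is the second
difference of `u` in the lattice direction `pᵢ - pⱼ`, in which `v` has cancelled; the pure second
differences in the three directions determine the mixed one. And the angle with edges `pᵢ, p₃` is
the first difference of `v - u`. Hence bounded energy bounds all second differences of `u` by
`O(ℓ)` in `ℓ²(ℤ²)`, and the first differences of `v - u` as well; as the supports have diameter
`O(1/ℓ)`, the discrete Poincaré inequality bounds the first differences of `u`, and `v - u`, by
`O(1)`, so that `v - u` disappears in the `L²` limit (`coercivity`, `NodalBounds`,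
`tendsto_eLpNorm_sub_comp_cell`).

Compactness comes from a discrete Morrey inequality: in two dimensions the mixed second differences
bound `u` uniformly and make it Hölder continuous of order `1/2` at scales above `ℓ`. An
Arzelà–Ascoli argument gives pointwise, hence `L²`, convergence of a subsequence of the functions
`x ↦ u (cell ℓ x)`, which are constant on the lattice parallelograms
(`exists_subseq_comp_cell_tendsto`). Since the parallelograms are permuted by the lattice
translations, the difference quotients of these functions with step `ℓ` along `d₁` and `d₂` are
exactly the scaled finite differences of `u`; they are bounded in `L²`, and their weak limits are
the weak derivatives of the limit (`memH2_of_comp_cell_tendsto`).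

The last statement is the classical fact that a function of `H²(ℝ²)` that vanishes outside a
bounded open set with the segment property belongs to `H²₀` of that set. The function is localized
by bump functions, and each piece is convolved with smooth kernels centred at `t y`, where `y` is
the direction of the segment property; this translates into `Ω` and mollifies at the same time
(`memH20_of_segmentProperty`).
-/

noncomputable section

namespace Graphene

/-! ### Finite differences on `ℤ²` -/

/-- The squared `ℓ²(ℤ²)` norm. It is only used for finitely supported functions, for which the sum
has no junk value. -/
def sqSum (f : ℤ × ℤ → ℝ) : ℝ := ∑' n, f n ^ 2

/-- `f` vanishes outside the box `[-N, N]²`. -/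
def BoxSupported (N : ℕ) (f : ℤ × ℤ → ℝ) : Prop :=
  ∀ n, f n ≠ 0 → |n.1| ≤ N ∧ |n.2| ≤ N

namespace BoxSupported

variable {N : ℕ} {f g : ℤ × ℤ → ℝ}

lemma finite_support (hf : BoxSupported N f) : f.support.Finite := by
  refine (Set.finite_Icc ((-N, -N) : ℤ × ℤ) (N, N)).subset fun n hn => ?_
  obtain ⟨h1, h2⟩ := hf n hn
  rw [abs_le] at h1 h2
  exact ⟨⟨h1.1, h2.1⟩, ⟨h1.2, h2.2⟩⟩

lemma summable_sq (hf : BoxSupported N f) : Summable fun n => f n ^ 2 :=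
  summable_of_hasFiniteSupport <| hf.finite_support.subset fun n hn => by
    simpa using hn

lemma sub (hf : BoxSupported N f) (hg : BoxSupported N g) :
    BoxSupported N fun n => f n - g n := by
  intro n hn
  by_cases h : f n = 0
  · exact hg n fun h' => hn (by simp [h, h'])
  · exact hf n h

lemma fwdDiff (hf : BoxSupported N f) {a : ℤ × ℤ} (ha1 : |a.1| ≤ 1) (ha2 : |a.2| ≤ 1) :
    BoxSupported (N + 1) (fwdDiff a f) := by
  intro n hn
  rw [abs_le] at ha1 ha2
  push_cast
  by_cases h : f n = 0
  · obtain ⟨h1, h2⟩ := hf (n + a) fun h' => hn (by simp [_root_.fwdDiff, h, h'])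
    simp only [Prod.fst_add, Prod.snd_add, abs_le] at h1 h2 ⊢
    omega
  · obtain ⟨h1, h2⟩ := hf n h
    simp only [abs_le] at h1 h2 ⊢
    omega

/-- A translation by more than the width of the box leads out of the support, so that `f` can be
recovered by summing its differences over at most `K` steps. -/
lemma eq_zero_or (hf : BoxSupported N f) {K : ℕ} (hK : 2 * N + 1 ≤ K) {a : ℤ × ℤ}
    (ha : a.1 = 1 ∨ a.2 = 1) (n : ℤ × ℤ) : f n = 0 ∨ f (n + K • a) = 0 := by
  by_contra! h
  obtain ⟨h1, h2⟩ := hf _ h.1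
  obtain ⟨h3, h4⟩ := hf _ h.2
  simp only [Prod.fst_add, Prod.snd_add, Prod.smul_fst, Prod.smul_snd, abs_le] at *
  rcases ha with ha | ha <;> simp only [ha, nsmul_eq_mul, mul_one] at h3 h4 <;> omega

end BoxSupported

lemma sqSum_comp_add (f : ℤ × ℤ → ℝ) (a : ℤ × ℤ) : sqSum (fun n => f (n + a)) = sqSum f :=
  (Equiv.addRight a).tsum_eq fun n => f n ^ 2

lemma sq_sub_le (f : ℤ × ℤ → ℝ) (a n : ℤ × ℤ) (K : ℕ) :
    (f (n + K • a) - f n) ^ 2 ≤ K * ∑ t ∈ Finset.range K, fwdDiff a f (n + t • a) ^ 2 := by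
  have h : f (n + K • a) - f n = ∑ t ∈ Finset.range K, fwdDiff a f (n + t • a) := by
    have := Finset.sum_range_sub (fun t : ℕ => f (n + t • a)) K
    simp only [zero_smul, add_zero] at this
    rw [← this]
    refine Finset.sum_congr rfl fun t _ => ?_
    simp only [fwdDiff, succ_nsmul, add_assoc]
  rw [h]
  simpa using sq_sum_le_card_mul_sum_sq (s := Finset.range K)
    (f := fun t => fwdDiff a f (n + t • a))

lemma sq_le_of_eq_zero_or {f : ℤ × ℤ → ℝ} {a n : ℤ × ℤ} {K : ℕ}
    (h : f n = 0 ∨ f (n + K • a) = 0) :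
    f n ^ 2 ≤ K * ∑ t ∈ Finset.range K, fwdDiff a f (n + t • a) ^ 2 := by
  rcases h with h | h
  · rw [h, zero_pow two_ne_zero]
    exact mul_nonneg K.cast_nonneg (Finset.sum_nonneg fun _ _ => sq_nonneg _)
  · have := sq_sub_le f a n K
    rwa [h, zero_sub, neg_sq] at this

/-- The discrete Poincaré inequality. -/
lemma sqSum_le_mul_sqSum_fwdDiff {f : ℤ × ℤ → ℝ} {a : ℤ × ℤ} {K N : ℕ}
    (hf : f.support.Finite) (hD : BoxSupported N (fwdDiff a f))
    (h : ∀ n, f n = 0 ∨ f (n + K • a) = 0) :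
    sqSum f ≤ (K : ℝ) ^ 2 * sqSum (fwdDiff a f) := by
  have hs : ∀ t : ℕ, HasSum (fun n => fwdDiff a f (n + t • a) ^ 2) (sqSum (fwdDiff a f)) :=
    fun t => (Equiv.addRight (t • a)).hasSum_iff.2 hD.summable_sq.hasSum
  have hs' := (hasSum_sum (s := Finset.range K) fun t _ => hs t).mul_left (K : ℝ)
  have hf' : Summable fun n => f n ^ 2 :=
    summable_of_hasFiniteSupport <| hf.subset fun n hn => by simpa using hn
  refine (hf'.hasSum.tsum_eq.le.trans
    (hasSum_le (fun n => sq_le_of_eq_zero_or (h n)) hf'.hasSum hs')).trans (le_of_eq ?_)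
  simp; ring

/-- A discrete Morrey inequality: the increment along `j` steps is controlled by the mixed second
differences over a strip of width `j` and length `K`. -/
lemma sq_sub_le_mul_sqSum {f : ℤ × ℤ → ℝ} {a b : ℤ × ℤ} {K N : ℕ}
    (hD : BoxSupported N (fwdDiff b (fwdDiff a f)))
    (h : ∀ n, fwdDiff a f n = 0 ∨ fwdDiff a f (n + K • b) = 0)
    (hab : ∀ n : ℤ × ℤ, Function.Injective fun q : ℕ × ℕ => n + q.1 • a + q.2 • b)
    (n : ℤ × ℤ) (j : ℕ) :
    (f (n + j • a) - f n) ^ 2 ≤ j * (K * sqSum (fwdDiff b (fwdDiff a f))) := by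
  refine (sq_sub_le f a n j).trans (mul_le_mul_of_nonneg_left ?_ (by positivity))
  calc ∑ s ∈ Finset.range j, fwdDiff a f (n + s • a) ^ 2
      ≤ ∑ s ∈ Finset.range j, (K : ℝ) * ∑ t ∈ Finset.range K,
          fwdDiff b (fwdDiff a f) (n + s • a + t • b) ^ 2 :=
        Finset.sum_le_sum fun s _ => sq_le_of_eq_zero_or (h _)
    _ = K * ∑ q ∈ Finset.range j ×ˢ Finset.range K,
          fwdDiff b (fwdDiff a f) (n + q.1 • a + q.2 • b) ^ 2 := by
        rw [← Finset.mul_sum, Finset.sum_product]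
    _ ≤ _ := by
        refine mul_le_mul_of_nonneg_left ?_ (by positivity)
        have hs := hD.summable_sq
        have := (hs.comp_injective (hab n)).sum_le_tsum (Finset.range j ×ˢ Finset.range K)
          fun q _ => sq_nonneg _
        exact this.trans (_root_.tsum_comp_le_tsum_of_inj hs (fun _ => sq_nonneg _) (hab n))

/-! ### Coercivity of the Z-dihedral energy -/

/-- The bond vectors in lattice coordinates: the neighbour `x + ℓ pᵢ` of the point of `L₂(ℓ)`
labelled `n` is the point of `L₁(ℓ)` labelled `n + bond i`. -/
def bond : Fin 3 → ℤ × ℤ := ![(1, 0), (0, 1), (0, 0)]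

/-- The Z-dihedral angle, up to its prefactor, in terms of the restrictions `u` and `v` of the
displacement to the two Bravais lattices. -/
def zig (u v : ℤ × ℤ → ℝ) (a b n : ℤ × ℤ) : ℝ :=
  v (n + a - b) - u (n + a) + u (n + b) - v n

section Coercivity

variable {u v : ℤ × ℤ → ℝ} {N : ℕ} {E : ℝ}

lemma summable_zig_sq (hu : BoxSupported N u) (hv : BoxSupported N v) (a b : ℤ × ℤ) :
    Summable fun n => zig u v a b n ^ 2 := by
  refine summable_of_hasFiniteSupport (Set.Finite.subset
    (((hv.finite_support.preimage ((add_left_injective (a - b)).injOn)).union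
      (hu.finite_support.preimage ((add_left_injective a).injOn))).union
      ((hu.finite_support.preimage ((add_left_injective b).injOn)).union hv.finite_support))
    fun n hn => ?_)
  by_contra h
  simp only [Set.mem_union, Set.mem_preimage, Function.mem_support, not_or, not_not,
    ← add_sub_assoc] at h
  exact hn (by simp [zig, h])

/-- The angles for `a, b` and for `b, a` shifted by `a - b` add up to a second difference of `u`
alone. -/
lemma sqSum_fwdDiff_fwdDiff_le (hu : BoxSupported N u) (hv : BoxSupported N v) {a b : ℤ × ℤ}
    (hab : sqSum (zig u v a b) ≤ E) (hba : sqSum (zig u v b a) ≤ E) :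
    Summable (fun n => fwdDiff (a - b) (fwdDiff (a - b) u) n ^ 2) ∧
      sqSum (fwdDiff (a - b) (fwdDiff (a - b) u)) ≤ 4 * E := by
  have h1 := summable_zig_sq hu hv a b
  have h2 : Summable fun n => zig u v b a (n + (a - b)) ^ 2 :=
    (Equiv.addRight (a - b)).summable_iff.2 (summable_zig_sq hu hv b a)
  have hle : ∀ n, fwdDiff (a - b) (fwdDiff (a - b) u) (n + b) ^ 2 ≤
      2 * zig u v a b n ^ 2 + 2 * zig u v b a (n + (a - b)) ^ 2 := by
    intro n
    have : fwdDiff (a - b) (fwdDiff (a - b) u) (n + b) =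
        zig u v a b n + zig u v b a (n + (a - b)) := by
      simp only [fwdDiff, zig]
      rw [show n + b + (a - b) = n + a by abel, show n + (a - b) + b = n + a by abel,
        show n + a + (a - b) = n + a - b + a by abel, show n + a - a = n by abel,
        show n + (a - b) = n + a - b by abel]
      ring
    rw [this]
    nlinarith [sq_nonneg (zig u v a b n - zig u v b a (n + (a - b)))]
  have h3 : Summable fun n => fwdDiff (a - b) (fwdDiff (a - b) u) (n + b) ^ 2 :=
    Summable.of_nonneg_of_le (fun _ => sq_nonneg _) hle ((h1.mul_left 2).add (h2.mul_left 2))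
  refine ⟨(Equiv.addRight b).summable_iff.1 h3, ?_⟩
  rw [← sqSum_comp_add _ b]
  have h4 := h3.tsum_le_tsum hle ((h1.mul_left 2).add (h2.mul_left 2))
  rw [(h1.mul_left 2).tsum_add (h2.mul_left 2), tsum_mul_left, tsum_mul_left] at h4
  have h5 := sqSum_comp_add (zig u v b a) (a - b)
  simp only [sqSum] at *
  linarith

/-- The second differences in the directions `a`, `b` and `a - b` determine the mixed one. -/
lemma sqSum_fwdDiff_mixed_le (hu : BoxSupported N u) (hv : BoxSupported N v) {a b : ℤ × ℤ}
    (hab : sqSum (zig u v a b) ≤ E) (hba : sqSum (zig u v b a) ≤ E)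
    (ha0 : sqSum (zig u v a 0) ≤ E) (h0a : sqSum (zig u v 0 a) ≤ E)
    (hb0 : sqSum (zig u v b 0) ≤ E) (h0b : sqSum (zig u v 0 b) ≤ E) :
    sqSum (fwdDiff b (fwdDiff a u)) ≤ 9 * E := by
  obtain ⟨s1, e1⟩ := sqSum_fwdDiff_fwdDiff_le hu hv hab hba
  obtain ⟨s2, e2⟩ := sqSum_fwdDiff_fwdDiff_le hu hv ha0 h0a
  obtain ⟨s3, e3⟩ := sqSum_fwdDiff_fwdDiff_le hu hv hb0 h0b
  simp only [sub_zero] at s2 e2 s3 e3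
  have s4 : Summable fun n => fwdDiff (a - b) (fwdDiff (a - b) u) (n + (b + b)) ^ 2 :=
    (Equiv.addRight (b + b)).summable_iff.2 s1
  have e4 := sqSum_comp_add (fwdDiff (a - b) (fwdDiff (a - b) u)) (b + b)
  have hle : ∀ n, fwdDiff b (fwdDiff a u) n ^ 2 ≤ 3 / 4 * fwdDiff a (fwdDiff a u) n ^ 2 +
      3 / 4 * fwdDiff b (fwdDiff b u) n ^ 2 +
      3 / 4 * fwdDiff (a - b) (fwdDiff (a - b) u) (n + (b + b)) ^ 2 := by
    intro n
    have : fwdDiff b (fwdDiff a u) n = 1 / 2 * (fwdDiff a (fwdDiff a u) n +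
        fwdDiff b (fwdDiff b u) n - fwdDiff (a - b) (fwdDiff (a - b) u) (n + (b + b))) := by
      simp only [fwdDiff]
      rw [show n + (b + b) + (a - b) + (a - b) = n + a + a by abel,
        show n + (b + b) + (a - b) = n + b + a by abel, show n + (b + b) = n + b + b by abel]
      ring
    rw [this]
    set x := fwdDiff a (fwdDiff a u) n
    set y := fwdDiff b (fwdDiff b u) n
    set z := fwdDiff (a - b) (fwdDiff (a - b) u) (n + (b + b))
    nlinarith [sq_nonneg (x - y), sq_nonneg (x + z), sq_nonneg (y + z)]
  have hs := ((s2.mul_left (3 / 4)).add (s3.mul_left (3 / 4))).add (s4.mul_left (3 / 4))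
  have h4 := (Summable.of_nonneg_of_le (fun _ => sq_nonneg _) hle hs).tsum_le_tsum hle hs
  rw [((s2.mul_left (3 / 4)).add (s3.mul_left (3 / 4))).tsum_add (s4.mul_left (3 / 4)),
    (s2.mul_left (3 / 4)).tsum_add (s3.mul_left (3 / 4)), tsum_mul_left, tsum_mul_left,
    tsum_mul_left] at h4
  simp only [sqSum] at *
  linarith

/-- The consequences of a bound on the six Z-dihedral sums: `ℓ²` bounds on the first and second
differences of `u`, pointwise bounds on `u` and its increments, and closeness of `u` and `v`. -/
lemma coercivity (hu : BoxSupported N u) (hv : BoxSupported N v)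
    (hE : ∀ i j, i ≠ j → sqSum (zig u v (bond i) (bond j)) ≤ E) {K : ℕ} (hK : 2 * N + 5 ≤ K) :
    (∀ i j : Fin 2, sqSum (fwdDiff (bond j.castSucc) (fwdDiff (bond i.castSucc) u)) ≤ 9 * E) ∧
    (∀ i : Fin 2, sqSum (fwdDiff (bond i.castSucc) u) ≤ (K : ℝ) ^ 2 * (9 * E)) ∧
    (∀ (i : Fin 2) (n : ℤ × ℤ) (j : ℕ),
      (u (n + j • bond i.castSucc) - u n) ^ 2 ≤ j * (K * (9 * E))) ∧
    (∀ n, u n ^ 2 ≤ (K : ℝ) ^ 2 * (9 * E)) ∧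
    sqSum u ≤ (K : ℝ) ^ 2 * ((K : ℝ) ^ 2 * (9 * E)) ∧
    sqSum (fun n => v n - u n) ≤ (K : ℝ) ^ 2 * E := by
  have b2 : bond 2 = 0 := rfl
  have hb : ∀ i : Fin 2, |(bond i.castSucc).1| ≤ 1 ∧ |(bond i.castSucc).2| ≤ 1 ∧
      ((bond i.castSucc).1 = 1 ∨ (bond i.castSucc).2 = 1) := by decide
  have hE01 := hE 0 1 (by decide)
  have hE10 := hE 1 0 (by decide)
  have hE02 := hE 0 2 (by decide)
  have hE20 := hE 2 0 (by decide)
  have hE12 := hE 1 2 (by decide)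
  have hE21 := hE 2 1 (by decide)
  rw [b2] at hE02 hE20 hE12 hE21
  have hE0 : 0 ≤ E := (tsum_nonneg fun _ => sq_nonneg _).trans hE01
  have hD1 : ∀ i : Fin 2, BoxSupported (N + 1) (fwdDiff (bond i.castSucc) u) := fun i =>
    hu.fwdDiff (hb i).1 (hb i).2.1
  have hD2 : ∀ i j : Fin 2,
      BoxSupported (N + 1 + 1) (fwdDiff (bond j.castSucc) (fwdDiff (bond i.castSucc) u)) :=
    fun i j => (hD1 i).fwdDiff (hb j).1 (hb j).2.1
  have hsec : ∀ i j : Fin 2,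
      sqSum (fwdDiff (bond j.castSucc) (fwdDiff (bond i.castSucc) u)) ≤ 9 * E := by
    intro i j
    fin_cases i <;> fin_cases j
    · have := (sqSum_fwdDiff_fwdDiff_le hu hv hE02 hE20).2
      rw [sub_zero] at this
      exact this.trans (by linarith)
    · exact sqSum_fwdDiff_mixed_le hu hv hE01 hE10 hE02 hE20 hE12 hE21
    · exact sqSum_fwdDiff_mixed_le hu hv hE10 hE01 hE12 hE21 hE02 hE20
    · have := (sqSum_fwdDiff_fwdDiff_le hu hv hE12 hE21).2
      rw [sub_zero] at this
      exact this.trans (by linarith)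
  have hinc : ∀ (i : Fin 2) (n : ℤ × ℤ) (j : ℕ),
      (u (n + j • bond i.castSucc) - u n) ^ 2 ≤ j * (K * (9 * E)) := by
    intro i n j
    have hij : ∀ i : Fin 2, ∀ n : ℤ × ℤ, Function.Injective fun q : ℕ × ℕ =>
        n + q.1 • bond i.castSucc + q.2 • bond (1 - i).castSucc := by
      intro i n q q' h
      fin_cases i <;> simp [bond, Prod.ext_iff] at h ⊢ <;> omega
    refine (sq_sub_le_mul_sqSum (hD2 i (1 - i)) (fun n => (hD1 i).eq_zero_or (K := K) (by omega)
      (hb _).2.2 n) (hij i) n j).trans ?_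
    have := hsec i (1 - i)
    gcongr
  have hfst : ∀ i : Fin 2,
      sqSum (fwdDiff (bond i.castSucc) u) ≤ (K : ℝ) ^ 2 * (9 * E) := by
    intro i
    refine (sqSum_le_mul_sqSum_fwdDiff (hD1 i).finite_support (hD2 i i) (K := K)
      fun n => (hD1 i).eq_zero_or (by omega) (hb i).2.2 n).trans ?_
    have := hsec i i
    gcongr
  refine ⟨hsec, hfst, hinc, fun n => ?_, ?_, ?_⟩
  · have hE9 : 0 ≤ (K : ℝ) ^ 2 * (9 * E) := by positivity
    have h1 := hinc 0 n K
    have h2 := hu.eq_zero_or (K := K) (by omega) (hb 0).2.2 n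
    rcases h2 with h2 | h2
    · rwa [h2, zero_pow two_ne_zero]
    · rw [h2] at h1
      nlinarith
  · refine (sqSum_le_mul_sqSum_fwdDiff hu.finite_support (hD1 0) (K := K)
      fun n => hu.eq_zero_or (by omega) (hb 0).2.2 n).trans ?_
    have := hfst 0
    gcongr
  · have h := hv.sub hu
    refine (sqSum_le_mul_sqSum_fwdDiff (a := bond 0) h.finite_support
      (h.fwdDiff (by decide) (by decide)) (K := K)
      fun n => h.eq_zero_or (by omega) (by decide) n).trans ?_
    -- The bond `p₃` has lattice coordinates zero.
    have : fwdDiff (bond 0) (fun n => v n - u n) = zig u v (bond 0) 0 := by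
      ext n
      simp only [fwdDiff, zig, add_zero, sub_zero]
      ring
    rw [this]
    gcongr

end Coercivity

/-! ### Lattice coordinates and the cells of the lattice -/

/-- The vectors `d₁`, `d₂` as a family. -/
def latVec : Fin 2 → Plane := ![d₁, d₂]

/-- The coordinates of a point with respect to the basis `d₁`, `d₂`. -/
def latCoord : Fin 2 → Plane →L[ℝ] ℝ :=
  ![(√3)⁻¹ • EuclideanSpace.proj 0 - (3 : ℝ)⁻¹ • EuclideanSpace.proj 1,
    (2 / 3 : ℝ) • EuclideanSpace.proj 1]

lemma latCoord_zero (x : Plane) : latCoord 0 x = (√3)⁻¹ * x 0 - 3⁻¹ * x 1 := by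
  simp [latCoord]

lemma latCoord_one (x : Plane) : latCoord 1 x = 2 / 3 * x 1 := by
  simp [latCoord]

lemma latCoord_latVec (i j : Fin 2) : latCoord i (latVec j) = if i = j then 1 else 0 := by
  have h3 : √3 ≠ 0 := by positivity
  fin_cases i <;> fin_cases j <;>
    simp [latCoord_zero, latCoord_one, latVec, d₁, d₂, h3] <;> (field_simp; norm_num)

lemma latCoord_shift (i : Fin 2) : latCoord i shift = 1 / 3 := by
  have h3 : √3 ≠ 0 := by positivity
  fin_cases i <;> simp [latCoord_zero, latCoord_one, shift] <;> field_simp <;> norm_num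

lemma plane_ext {x y : Plane} (h : ∀ i, latCoord i x = latCoord i y) : x = y := by
  have h3 : (√3)⁻¹ ≠ 0 := by positivity
  have h0 := h 0
  have h1 := h 1
  simp only [latCoord_zero, latCoord_one] at h0 h1
  have h1' : x 1 = y 1 := by linarith
  have h0' : x 0 = y 0 := mul_left_cancel₀ h3 (by rw [h1'] at h0; linarith)
  ext i
  fin_cases i <;> assumption

lemma sum_latCoord_smul (x : Plane) : latCoord 0 x • d₁ + latCoord 1 x • d₂ = x := by
  refine plane_ext fun i => ?_
  have h1 := latCoord_latVec i 0
  have h2 := latCoord_latVec i 1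
  simp only [latVec, Matrix.cons_val_zero, Matrix.cons_val_one] at h1 h2
  rw [map_add, map_smul, map_smul, h1, h2]
  fin_cases i <;> simp

lemma latCoord_d₁ : latCoord 0 d₁ = 1 ∧ latCoord 1 d₁ = 0 :=
  ⟨by simpa [latVec] using latCoord_latVec 0 0, by simpa [latVec] using latCoord_latVec 1 0⟩

lemma latCoord_d₂ : latCoord 0 d₂ = 0 ∧ latCoord 1 d₂ = 1 :=
  ⟨by simpa [latVec] using latCoord_latVec 0 1, by simpa [latVec] using latCoord_latVec 1 1⟩

lemma latCoord_node (ℓ : ℝ) (m : Fin 2) (n : ℤ × ℤ) :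
    latCoord 0 (node ℓ m n) = ℓ * (n.1 + ((m : ℕ) : ℝ) / 3) ∧
      latCoord 1 (node ℓ m n) = ℓ * (n.2 + ((m : ℕ) : ℝ) / 3) := by
  simp only [node, map_add, map_smul, latCoord_d₁, latCoord_d₂, latCoord_shift, smul_eq_mul]
  constructor <;> ring

lemma latCoord_p :
    (latCoord 0 (p 0) = 2 / 3 ∧ latCoord 1 (p 0) = -1 / 3) ∧
    (latCoord 0 (p 1) = -1 / 3 ∧ latCoord 1 (p 1) = 2 / 3) ∧
    (latCoord 0 (p 2) = -1 / 3 ∧ latCoord 1 (p 2) = -1 / 3) := by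
  simp only [p, Matrix.cons_val_zero, Matrix.cons_val_one, Matrix.cons_val, map_sub, map_neg,
    latCoord_d₁, latCoord_d₂, latCoord_shift]
  norm_num

lemma abs_latCoord_le (i : Fin 2) (x : Plane) : |latCoord i x| ≤ ‖x‖ := by
  have h0 : ‖x‖ ^ 2 = x 0 ^ 2 + x 1 ^ 2 := by
    simp [EuclideanSpace.norm_sq_eq, Fin.sum_univ_two]
  have h3 : (√3)⁻¹ * (√3)⁻¹ = 1 / 3 := by
    rw [← mul_inv, Real.mul_self_sqrt (by norm_num)]; norm_num
  refine abs_le_of_sq_le_sq ?_ (norm_nonneg x)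
  rw [h0]
  fin_cases i
  · simp only [Fin.zero_eta, latCoord_zero]
    nlinarith [sq_nonneg ((√3)⁻¹ * x 0 + 3⁻¹ * x 1), sq_nonneg (x 0), sq_nonneg (x 1)]
  · simp only [Fin.mk_one, latCoord_one]
    nlinarith [sq_nonneg (x 0), sq_nonneg (x 1)]

lemma norm_le_latCoord (x : Plane) : ‖x‖ ≤ 2 * (|latCoord 0 x| + |latCoord 1 x|) := by
  have h3 : √3 ^ 2 = 3 := Real.sq_sqrt (by norm_num)
  have n1 : ‖d₁‖ ≤ 2 := by
    rw [EuclideanSpace.norm_eq, Real.sqrt_le_left (by norm_num)]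
    simp [d₁, Fin.sum_univ_two]
    norm_num
  have n2 : ‖d₂‖ ≤ 2 := by
    rw [EuclideanSpace.norm_eq, Real.sqrt_le_left (by norm_num)]
    simp [d₂, Fin.sum_univ_two, div_pow]
    norm_num
  conv_lhs => rw [← sum_latCoord_smul x]
  refine (norm_add_le _ _).trans ?_
  rw [norm_smul, norm_smul, Real.norm_eq_abs, Real.norm_eq_abs]
  nlinarith [abs_nonneg (latCoord 0 x), abs_nonneg (latCoord 1 x)]

/-- The label `n` of the lattice parallelogram containing `x`: the half-open parallelogram with
corners `ℓ (n + {0,1}² - (1/3, 1/3))` in lattice coordinates, which is the union of the triangle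
centred at `node ℓ 0 n` and the triangle centred at `node ℓ 1 n`, up to null sets. -/
def cell (ℓ : ℝ) (x : Plane) : ℤ × ℤ :=
  (⌊latCoord 0 x / ℓ + 1 / 3⌋, ⌊latCoord 1 x / ℓ + 1 / 3⌋)

lemma measurable_cell (ℓ : ℝ) : Measurable (cell ℓ) := by
  have h : ∀ i, Measurable fun x => latCoord i x / ℓ + 1 / 3 := fun i =>
    (((latCoord i).continuous.measurable).div_const ℓ).add_const _
  exact (h 0).floor.prodMk (h 1).floor

lemma cell_add (ℓ : ℝ) (hℓ : ℓ ≠ 0) (x : Plane) (i : Fin 2) :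
    cell ℓ (x + ℓ • latVec i) = cell ℓ x + bond i.castSucc := by
  have h : ∀ j, latCoord j (x + ℓ • latVec i) / ℓ + 1 / 3 =
      latCoord j x / ℓ + 1 / 3 + ((if j = i then 1 else 0 : ℤ) : ℝ) := by
    intro j
    rw [map_add, map_smul, latCoord_latVec, smul_eq_mul]
    split_ifs
    · field_simp; push_cast; ring
    · simp
  simp only [cell, h, Int.floor_add_intCast, Prod.ext_iff, Prod.fst_add, Prod.snd_add]
  fin_cases i <;> simp [bond]

/-- Half-open bounds on the coordinates of `x` relative to its cell. -/
lemma cell_spec (ℓ : ℝ) (x : Plane) :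
    (0 ≤ latCoord 0 x / ℓ + 1 / 3 - (cell ℓ x).1 ∧ latCoord 0 x / ℓ + 1 / 3 - (cell ℓ x).1 < 1) ∧
    (0 ≤ latCoord 1 x / ℓ + 1 / 3 - (cell ℓ x).2 ∧ latCoord 1 x / ℓ + 1 / 3 - (cell ℓ x).2 < 1) :=
  ⟨⟨Int.fract_nonneg _, Int.fract_lt_one _⟩, ⟨Int.fract_nonneg _, Int.fract_lt_one _⟩⟩

lemma dist_node_cell_le {ℓ : ℝ} (hℓ : 0 < ℓ) (x : Plane) :
    dist x (node ℓ 0 (cell ℓ x)) ≤ 4 * ℓ := by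
  obtain ⟨⟨h1, h2⟩, h3, h4⟩ := cell_spec ℓ x
  rw [dist_eq_norm]
  refine (norm_le_latCoord _).trans ?_
  have e : ∀ (i : Fin 2) (k : ℤ), 0 ≤ latCoord i x / ℓ + 1 / 3 - k →
      latCoord i x / ℓ + 1 / 3 - k < 1 → |latCoord i x - ℓ * k| ≤ ℓ := by
    intro i k hk hk'
    have : latCoord i x - ℓ * k = ℓ * (latCoord i x / ℓ + 1 / 3 - k) - ℓ * (1 / 3) := by
      field_simp; ring
    rw [this, abs_le]
    constructor <;> nlinarith
  have e0 := e 0 _ h1 h2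
  have e1 := e 1 _ h3 h4
  rw [map_sub, map_sub, (latCoord_node ℓ 0 _).1, (latCoord_node ℓ 0 _).2]
  simp only [Fin.val_zero, Nat.cast_zero, zero_div, add_zero]
  linarith

/-- A bound on the area of the cells of the lattice of size `1`. -/
def cellArea : ℝ := (volume (Metric.closedBall (0 : Plane) 4)).toReal

lemma cellArea_nonneg : 0 ≤ cellArea := ENNReal.toReal_nonneg

lemma volume_cell_le {ℓ : ℝ} (hℓ : 0 < ℓ) (n : ℤ × ℤ) :
    volume (cell ℓ ⁻¹' {n}) ≤ ENNReal.ofReal (ℓ ^ 2 * cellArea) := by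
  have hsub : cell ℓ ⁻¹' {n} ⊆ Metric.closedBall (node ℓ 0 n) (ℓ * 4) := by
    intro x hx
    have := dist_node_cell_le hℓ x
    rw [show cell ℓ x = n from hx] at this
    rw [Metric.mem_closedBall]
    linarith
  refine (measure_mono hsub).trans ?_
  rw [Measure.addHaar_closedBall_mul _ _ hℓ.le (by norm_num), cellArea,
    ENNReal.ofReal_mul (by positivity),
    ENNReal.ofReal_toReal (measure_closedBall_lt_top).ne]
  simp

/-- Integrals of functions constant on the cells are bounded by lattice sums. -/
lemma lintegral_cell_le {ℓ : ℝ} (hℓ : 0 < ℓ) {g : ℤ × ℤ → ℝ} (hg : Summable fun n => g n ^ 2) :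
    ∫⁻ x, ENNReal.ofReal (g (cell ℓ x) ^ 2) ≤ ENNReal.ofReal (ℓ ^ 2 * cellArea * sqSum g) := by
  have h1 : ∫⁻ x, ENNReal.ofReal (g (cell ℓ x) ^ 2) =
      ∫⁻ n, ENNReal.ofReal (g n ^ 2) ∂(Measure.map (cell ℓ) volume) := by
    rw [lintegral_map (measurable_of_countable _) (measurable_cell ℓ)]
  rw [h1, lintegral_countable', mul_comm, sqSum, ENNReal.ofReal_mul (tsum_nonneg fun _ => sq_nonneg _),
    ENNReal.ofReal_tsum_of_nonneg (fun _ => sq_nonneg _) hg, ← ENNReal.tsum_mul_right]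
  refine ENNReal.tsum_le_tsum fun n => ?_
  gcongr
  rw [Measure.map_apply (measurable_cell ℓ) (measurableSet_singleton n)]
  exact volume_cell_le hℓ n

/-! ### Triangles and admissible displacements -/

/-- The two triangles of the cell `n` in terms of the coordinates `α, β` of `x` relative to the
corner of the cell: `α + β ≤ 1` for the one centred in `L₁(ℓ)`, `α + β ≥ 1` for the one centred in
`L₂(ℓ)`. -/
lemma mem_convexHull_of_coords {ℓ : ℝ} (hℓ : 0 < ℓ) (m : Fin 2) (n : ℤ × ℤ) (x : Plane)
    (α β : ℝ) (hα : latCoord 0 x / ℓ + 1 / 3 - n.1 = α) (hβ : latCoord 1 x / ℓ + 1 / 3 - n.2 = β)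
    (h : if m = 0 then 0 ≤ α ∧ 0 ≤ β ∧ α + β ≤ 1 else α ≤ 1 ∧ β ≤ 1 ∧ 1 ≤ α + β) :
    x ∈ convexHull ℝ
      (Set.range fun i : Fin 3 => node ℓ m n + (if m = 0 then ℓ else -ℓ) • p i) := by
  obtain ⟨⟨p00, p01⟩, ⟨p10, p11⟩, p20, p21⟩ := latCoord_p
  -- The barycentric coordinates of `x`.
  set c : Fin 3 → ℝ := if m = 0 then ![α, β, 1 - α - β] else ![1 - α, 1 - β, α + β - 1] with hc
  have hx : x = ∑ i, c i • (node ℓ m n + (if m = 0 then ℓ else -ℓ) • p i) := by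
    have e0 : latCoord 0 x = ℓ * (α + n.1 - 1 / 3) := by rw [← hα]; field_simp; ring
    have e1 : latCoord 1 x = ℓ * (β + n.2 - 1 / 3) := by rw [← hβ]; field_simp; ring
    refine plane_ext fun i => ?_
    rw [Fin.sum_univ_three]
    simp only [map_add, map_smul, smul_eq_mul]
    fin_cases m <;> fin_cases i <;>
      simp [hc, e0, e1, latCoord_node, p00, p01, p10, p11, p20, p21] <;> ring
  rw [hx]
  refine (convex_convexHull ℝ _).sum_mem (fun i _ => ?_) ?_ fun i _ =>
    subset_convexHull _ _ ⟨i, rfl⟩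
  · fin_cases m <;> simp only [hc] <;> simp at h ⊢ <;> fin_cases i <;> (simp; linarith)
  · rw [Fin.sum_univ_three]
    fin_cases m <;> simp only [hc] <;> simp <;> ring

lemma node_mem_triangle {ℓ : ℝ} (hℓ : 0 < ℓ) (m : Fin 2) (n : ℤ × ℤ) :
    node ℓ m n ∈ triangle ℓ m n := by
  set A : Plane → ℝ := fun x => latCoord 0 x / ℓ + 1 / 3 - n.1 with hA
  set B : Plane → ℝ := fun x => latCoord 1 x / ℓ + 1 / 3 - n.2 with hB
  have cA : Continuous A := by fun_prop
  have cB : Continuous B := by fun_prop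
  have nA : A (node ℓ m n) = ((m : ℕ) : ℝ) / 3 + 1 / 3 := by
    simp only [hA, (latCoord_node ℓ m n).1]; field_simp; ring
  have nB : B (node ℓ m n) = ((m : ℕ) : ℝ) / 3 + 1 / 3 := by
    simp only [hB, (latCoord_node ℓ m n).2]; field_simp; ring
  refine mem_interior.2 ?_
  fin_cases m
  · refine ⟨{x | 0 < A x} ∩ {x | 0 < B x} ∩ {x | A x + B x < 1}, fun x hx => ?_,
      ((isOpen_lt continuous_const cA).inter (isOpen_lt continuous_const cB)).inter
        (isOpen_lt (cA.add cB) continuous_const), ?_⟩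
    · exact mem_convexHull_of_coords hℓ 0 n x _ _ rfl rfl
        (by rw [if_pos rfl]; exact ⟨le_of_lt hx.1.1, le_of_lt hx.1.2, le_of_lt hx.2⟩)
    · simp only [Set.mem_inter_iff, Set.mem_ofPred_eq, nA, nB]; norm_num
  · refine ⟨{x | A x < 1} ∩ {x | B x < 1} ∩ {x | 1 < A x + B x}, fun x hx => ?_,
      ((isOpen_lt cA continuous_const).inter (isOpen_lt cB continuous_const)).inter
        (isOpen_lt continuous_const (cA.add cB)), ?_⟩
    · exact mem_convexHull_of_coords hℓ 1 n x _ _ rfl rfl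
        (by rw [if_neg one_ne_zero]; exact ⟨le_of_lt hx.1.1, le_of_lt hx.1.2, le_of_lt hx.2⟩)
    · simp only [Set.mem_inter_iff, Set.mem_ofPred_eq, nA, nB]; norm_num

/-- Almost every point lies in one of the two open triangles of its cell: the edges are null. -/
lemma ae_mem_triangle {ℓ : ℝ} (hℓ : 0 < ℓ) :
    ∀ᵐ x : Plane, ∃ m, x ∈ triangle ℓ m (cell ℓ x) := by
  have hnull : ∀ᵐ x : Plane, ∀ (m : Fin 2) (n : ℤ × ℤ), x ∉ frontier (convexHull ℝ
      (Set.range fun i : Fin 3 => node ℓ m n + (if m = 0 then ℓ else -ℓ) • p i)) := by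
    rw [ae_all_iff]; intro m
    rw [ae_all_iff]; intro n
    exact measure_eq_zero_iff_ae_notMem.1 ((convex_convexHull ℝ _).addHaar_frontier volume)
  filter_upwards [hnull] with x hx
  have hmem : ∃ m : Fin 2, x ∈ convexHull ℝ (Set.range fun i : Fin 3 =>
      node ℓ m (cell ℓ x) + (if m = 0 then ℓ else -ℓ) • p i) := by
    obtain ⟨⟨h1, h2⟩, h3, h4⟩ := cell_spec ℓ x
    rcases le_total ((latCoord 0 x / ℓ + 1 / 3 - (cell ℓ x).1) +
      (latCoord 1 x / ℓ + 1 / 3 - (cell ℓ x).2)) 1 with h | h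
    · exact ⟨0, mem_convexHull_of_coords hℓ 0 _ x _ _ rfl rfl (by rw [if_pos rfl]; exact ⟨h1, h3, h⟩)⟩
    · exact ⟨1, mem_convexHull_of_coords hℓ 1 _ x _ _ rfl rfl
        (by rw [if_neg one_ne_zero]; exact ⟨h2.le, h4.le, h⟩)⟩
  obtain ⟨m, hm⟩ := hmem
  refine ⟨m, ?_⟩
  by_contra h
  exact hx m _ ⟨subset_closure hm, h⟩

section Admissible

variable {Ω : Set Plane} {ℓ : ℝ} {w : Plane → ℝ}

lemma Admissible.ae_eq (hℓ : 0 < ℓ) (hw : w ∈ Admissible Ω ℓ) :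
    ∀ᵐ x, w x = w (node ℓ 0 (cell ℓ x)) ∨ w x = w (node ℓ 1 (cell ℓ x)) := by
  filter_upwards [ae_mem_triangle hℓ] with x ⟨m, hm⟩
  have := hw.2.1 m _ x hm
  fin_cases m
  · exact .inl this
  · exact .inr this

lemma Admissible.ae_eq_zero (hℓ : 0 < ℓ) (hw : w ∈ Admissible Ω ℓ) :
    ∀ᵐ x, x ∉ Ω → w x = 0 := by
  filter_upwards [ae_mem_triangle hℓ] with x ⟨m, hm⟩ hx
  exact hw.2.2 m _ (fun h => hx (h hm)) x hm

lemma Admissible.node_mem (hℓ : 0 < ℓ) (hw : w ∈ Admissible Ω ℓ) {m : Fin 2} {n : ℤ × ℤ}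
    (h : w (node ℓ m n) ≠ 0) : node ℓ m n ∈ Ω := by
  by_contra hx
  exact h (hw.2.2 m n (fun h => hx (h (node_mem_triangle hℓ m n))) _ (node_mem_triangle hℓ m n))

/-- For `Ω` in a ball of radius `R`, the nodal values are supported in a box of size `O(1/ℓ)`. -/
lemma Admissible.boxSupported (hℓ : 0 < ℓ) (hw : w ∈ Admissible Ω ℓ) {R : ℝ}
    (hR : ∀ x ∈ Ω, ‖x‖ ≤ R) {N : ℕ} (hN : R / ℓ + 1 ≤ N) (m : Fin 2) :
    BoxSupported N fun n => w (node ℓ m n) := by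
  intro n hn
  have hx := hR _ (Admissible.node_mem hℓ hw hn)
  have h0 := (abs_latCoord_le 0 _).trans hx
  have h1 := (abs_latCoord_le 1 _).trans hx
  rw [(latCoord_node ℓ m n).1, abs_mul, abs_of_pos hℓ, mul_comm, ← le_div_iff₀ hℓ] at h0
  rw [(latCoord_node ℓ m n).2, abs_mul, abs_of_pos hℓ, mul_comm, ← le_div_iff₀ hℓ] at h1
  have hm : 0 ≤ ((m : ℕ) : ℝ) / 3 ∧ ((m : ℕ) : ℝ) / 3 ≤ 1 := by
    fin_cases m <;> norm_num
  rw [abs_le] at h0 h1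
  constructor
  · rw [abs_le]
    have e1 : -(N : ℝ) ≤ n.1 := by linarith
    have e2 : (n.1 : ℝ) ≤ N := by linarith
    exact ⟨by exact_mod_cast e1, by exact_mod_cast e2⟩
  · rw [abs_le]
    have e1 : -(N : ℝ) ≤ n.2 := by linarith
    have e2 : (n.2 : ℝ) ≤ N := by linarith
    exact ⟨by exact_mod_cast e1, by exact_mod_cast e2⟩

end Admissible

/-! ### The energy in lattice coordinates -/

lemma node_one_add (ℓ : ℝ) (n : ℤ × ℤ) (i : Fin 3) :
    node ℓ 1 n + ℓ • p i = node ℓ 0 (n + bond i) := by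
  obtain ⟨⟨p00, p01⟩, ⟨p10, p11⟩, p20, p21⟩ := latCoord_p
  refine plane_ext fun j => ?_
  rw [map_add, map_smul, smul_eq_mul]
  fin_cases i <;> fin_cases j <;>
    simp [latCoord_node, p00, p01, p10, p11, p20, p21, bond] <;> ring

lemma node_one_add_sub (ℓ : ℝ) (n : ℤ × ℤ) (i j : Fin 3) :
    node ℓ 1 n + ℓ • p i - ℓ • p j = node ℓ 1 (n + bond i - bond j) := by
  rw [node_one_add, sub_eq_iff_eq_add, node_one_add, sub_add_cancel]

lemma thetaZ_node (ℓ : ℝ) (w : Plane → ℝ) (i j : Fin 3) (n : ℤ × ℤ) :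
    thetaZ ℓ w i j (node ℓ 1 n) = 2 * √3 / (3 * ℓ) *
      zig (fun n => w (node ℓ 0 n)) (fun n => w (node ℓ 1 n)) (bond i) (bond j) n := by
  rw [thetaZ, node_one_add_sub, node_one_add, node_one_add, zig]

/-- Bounded energy bounds each of the six Z-dihedral sums, since the other energies are
nonnegative. -/
lemma sqSum_zig_le {kZ kC τ₀ ℓ M : ℝ} (hkZ : 0 < kZ) (hkC : 0 ≤ kC) (hτ₀ : τ₀ ≤ 0)
    (hℓ : 0 < ℓ) {w : Plane → ℝ} (hM : energy kZ kC τ₀ ℓ w ≤ M) {N : ℕ}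
    (hu : BoxSupported N fun n => w (node ℓ 0 n)) (hv : BoxSupported N fun n => w (node ℓ 1 n))
    {i j : Fin 3} (hij : i ≠ j) :
    sqSum (zig (fun n => w (node ℓ 0 n)) (fun n => w (node ℓ 1 n)) (bond i) (bond j)) ≤
      3 * M / (2 * kZ) * ℓ ^ 2 := by
  set Z : Fin 3 → Fin 3 → ℤ × ℤ → ℝ := fun i j =>
    zig (fun n => w (node ℓ 0 n)) (fun n => w (node ℓ 1 n)) (bond i) (bond j) with hZ
  have hs : ∀ i j, Summable fun n => Z i j n ^ 2 := fun i j => summable_zig_sq hu hv _ _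
  have hC : 0 ≤ energyC kC ℓ w :=
    mul_nonneg (by positivity)
      (tsum_nonneg fun n => Finset.sum_nonneg fun i _ => by positivity)
  have hS : 0 ≤ energyS τ₀ ℓ w :=
    mul_nonneg (by linarith) (add_nonneg (tsum_nonneg fun _ => sq_nonneg _)
      (tsum_nonneg fun _ => sq_nonneg _))
  have hc : (2 * √3 / (3 * ℓ)) ^ 2 = 4 / (3 * ℓ ^ 2) := by
    rw [div_pow, mul_pow, Real.sq_sqrt (by norm_num)]; field_simp; norm_num
  have hE : energyZ kZ ℓ w =
      1 / 2 * kZ * ∑' n, 4 / (3 * ℓ ^ 2) * ∑ i, (Z i (i + 1) n ^ 2 + Z i (i + 2) n ^ 2) := by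
    simp only [energyZ, thetaZ_node, mul_pow, hc, ← mul_add, ← Finset.mul_sum, hZ]
  have hs' : Summable fun n => ∑ i, (Z i (i + 1) n ^ 2 + Z i (i + 2) n ^ 2) :=
    summable_sum fun i _ => (hs _ _).add (hs _ _)
  have hle : sqSum (Z i j) ≤ ∑' n, ∑ i, (Z i (i + 1) n ^ 2 + Z i (i + 2) n ^ 2) := by
    refine (hs i j).tsum_le_tsum (fun n => ?_) hs'
    have h1 : Z i j n ^ 2 ≤ Z i (i + 1) n ^ 2 + Z i (i + 2) n ^ 2 := by
      have : j = i + 1 ∨ j = i + 2 := by revert hij; revert i j; decide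
      rcases this with rfl | rfl
      · exact le_add_of_nonneg_right (sq_nonneg _)
      · exact le_add_of_nonneg_left (sq_nonneg _)
    exact h1.trans (Finset.single_le_sum
      (f := fun i => Z i (i + 1) n ^ 2 + Z i (i + 2) n ^ 2)
      (fun i _ => by positivity) (Finset.mem_univ i))
  have hEM : energyZ kZ ℓ w ≤ M := by
    unfold energy at hM; linarith
  rw [hE, tsum_mul_left] at hEM
  refine hle.trans ?_
  set S := ∑' n, ∑ i, (Z i (i + 1) n ^ 2 + Z i (i + 2) n ^ 2)
  rw [div_mul_eq_mul_div, le_div_iff₀ (by positivity)]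
  have : 1 / 2 * kZ * (4 / (3 * ℓ ^ 2) * S) = 2 * kZ * S / (3 * ℓ ^ 2) := by field_simp; norm_num
  rw [this, div_le_iff₀ (by positivity)] at hEM
  linarith

/-! ### Convergence and pairing in `L²` -/

lemma eLpNorm_two_sq {α : Type*} [MeasurableSpace α] (f : α → ℝ) (μ : Measure α) :
    eLpNorm f 2 μ ^ 2 = ∫⁻ x, ‖f x‖ₑ ^ 2 ∂μ := by
  have := eLpNorm_nnreal_pow_eq_lintegral (f := f) (μ := μ) (p := 2) two_ne_zero
  simpa using this

lemma tendsto_eLpNorm_two {ι α : Type*} [MeasurableSpace α] {μ : Measure α} {l : Filter ι}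
    {f : ι → α → ℝ} (h : Tendsto (fun k => ∫⁻ x, ‖f k x‖ₑ ^ 2 ∂μ) l (𝓝 0)) :
    Tendsto (fun k => eLpNorm (f k) 2 μ) l (𝓝 0) := by
  simp_rw [← eLpNorm_two_sq] at h
  have h2 := h.ennrpow_const (1 / 2)
  have e : ∀ a : ENNReal, (a ^ 2) ^ (1 / 2 : ℝ) = a := fun a => by
    rw [← ENNReal.rpow_natCast, ← ENNReal.rpow_mul]; norm_num
  simp_rw [e] at h2
  simpa using h2

/-- Bounded convergence in `L²` for functions supported in a fixed ball. -/
lemma tendsto_eLpNorm_sub_of_bounded {f : ℕ → Plane → ℝ} {g : Plane → ℝ} {M R : ℝ}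
    (hf : ∀ k, Measurable (f k))
    (hM : ∀ᶠ k in atTop, ∀ x, |f k x| ≤ M) (hR : ∀ᶠ k in atTop, ∀ x, R < ‖x‖ → f k x = 0)
    (hg : ∀ x, Tendsto (fun k => f k x) atTop (𝓝 (g x))) :
    Tendsto (fun k => eLpNorm (f k - g) 2 volume) atTop (𝓝 0) := by
  have hgm : Measurable g := measurable_of_tendsto_metrizable hf (tendsto_pi_nhds.2 hg)
  have hgM : ∀ x, |g x| ≤ M := fun x =>
    le_of_tendsto (hg x).abs (hM.mono fun k hk => hk x)
  have hgR : ∀ x, R < ‖x‖ → g x = 0 := fun x hx =>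
    tendsto_nhds_unique (hg x) (tendsto_const_nhds.congr' (hR.mono fun k hk => (hk x hx).symm))
  refine tendsto_eLpNorm_two ?_
  have h0 : ∫⁻ _ : Plane, (0 : ENNReal) = 0 := lintegral_zero
  rw [← h0]
  refine tendsto_lintegral_filter_of_dominated_convergence
    ((Metric.closedBall (0 : Plane) R).indicator fun _ => ENNReal.ofReal (2 * M) ^ 2)
    (.of_forall fun k => ((hf k).sub hgm).enorm.pow_const 2) ?_ ?_ (.of_forall fun x => ?_)
  · filter_upwards [hM, hR] with k hk hk'
    refine .of_forall fun x => ?_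
    by_cases hx : ‖x‖ ≤ R
    · rw [Set.indicator_of_mem (by simpa using hx)]
      gcongr
      rw [← ofReal_norm]
      refine ENNReal.ofReal_le_ofReal ((abs_sub _ _).trans ?_)
      linarith [hk x, hgM x]
    · rw [not_le] at hx
      simp [hk' x hx, hgR x hx]
  · rw [lintegral_indicator Metric.isClosed_closedBall.measurableSet, setLIntegral_const]
    exact ENNReal.mul_ne_top (by finiteness) measure_closedBall_lt_top.ne
  · have h1 : Tendsto (fun k => f k x - g x) atTop (𝓝 0) := by
      simpa using (hg x).sub_const (g x)
    have h2 := ((ENNReal.continuous_pow 2).tendsto _).comp h1.enorm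
    simpa using! h2

lemma inner_toLp_toLp {f g : Plane → ℝ} (hf : MemLp f 2 volume) (hg : MemLp g 2 volume) :
    inner ℝ (hf.toLp f) (hg.toLp g) = ∫ x, f x * g x := by
  rw [L2.inner_def]
  refine integral_congr_ae ?_
  filter_upwards [hf.coeFn_toLp, hg.coeFn_toLp] with x h1 h2
  rw [h1, h2]
  simp [mul_comm]

lemma abs_integral_mul_le {f g : Plane → ℝ} (hf : MemLp f 2 volume) (hg : MemLp g 2 volume) :
    |∫ x, f x * g x| ≤ (eLpNorm f 2 volume).toReal * (eLpNorm g 2 volume).toReal := by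
  rw [← inner_toLp_toLp hf hg, ← Lp.norm_toLp f hf, ← Lp.norm_toLp g hg]
  exact abs_real_inner_le_norm _ _

lemma integrable_mul {f g : Plane → ℝ} (hf : MemLp f 2 volume) (hg : MemLp g 2 volume) :
    Integrable fun x => f x * g x :=
  hf.integrable_mul hg

/-- Pairings of a bounded sequence with a strongly convergent one. -/
lemma tendsto_integral_mul {G φ : ℕ → Plane → ℝ} {ψ : Plane → ℝ} {C : NNReal} {a : ℝ}
    (hG : ∀ k, MemLp (G k) 2 volume) (hC : ∀ k, eLpNorm (G k) 2 volume ≤ C)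
    (hφ : ∀ k, MemLp (φ k) 2 volume) (hψ : MemLp ψ 2 volume)
    (hφψ : Tendsto (fun k => eLpNorm (φ k - ψ) 2 volume) atTop (𝓝 0))
    (h : Tendsto (fun k => ∫ x, G k x * ψ x) atTop (𝓝 a)) :
    Tendsto (fun k => ∫ x, G k x * φ k x) atTop (𝓝 a) := by
  have h0 : Tendsto (fun k => ∫ x, G k x * (φ k - ψ) x) atTop (𝓝 0) := by
    have h1 : Tendsto (fun k => (C : ℝ) * (eLpNorm (φ k - ψ) 2 volume).toReal) atTop (𝓝 0) := by
      simpa using ((ENNReal.tendsto_toReal ENNReal.zero_ne_top).comp hφψ).const_mul (C : ℝ)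
    refine squeeze_zero_norm (fun k => ?_) h1
    refine (abs_integral_mul_le (hG k) ((hφ k).sub hψ)).trans ?_
    gcongr
    exact ENNReal.toReal_le_coe_of_le_coe (hC k)
  have h2 := h.add h0
  rw [add_zero] at h2
  refine h2.congr fun k => ?_
  rw [← integral_add (integrable_mul (hG k) hψ) (integrable_mul (hG k) ((hφ k).sub hψ))]
  exact integral_congr_ae (.of_forall fun x => by simp only [Pi.sub_apply]; ring)

/-- Bounded sequences in a Hilbert space have weak cluster points: Banach–Alaoglu along an
ultrafilter. -/
lemma exists_weak_cluster_hilbert {E : Type*} [NormedAddCommGroup E] [InnerProductSpace ℝ E]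
    [CompleteSpace E] {x : ℕ → E} {C : ℝ} (hC : ∀ k, ‖x k‖ ≤ C) :
    ∃ y : E, ∀ (z : E) (a : ℝ), Tendsto (fun k => inner ℝ (x k) z) atTop (𝓝 a) →
      inner ℝ y z = a := by
  set D : ℕ → WeakDual ℝ E := fun k =>
    StrongDual.toWeakDual (InnerProductSpace.toDual ℝ E (x k)) with hD
  have hmem : ∀ k, D k ∈ WeakDual.toStrongDual ⁻¹' Metric.closedBall (0 : StrongDual ℝ E) C := by
    intro k
    have : ‖InnerProductSpace.toDual ℝ E (x k)‖ ≤ C := by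
      rw [LinearIsometryEquiv.norm_map]
      exact hC k
    exact mem_closedBall_zero_iff.2 this
  obtain ⟨ξ, -, hξ⟩ := (WeakDual.isCompact_closedBall (𝕜 := ℝ)
    (0 : StrongDual ℝ E) C).ultrafilter_le_nhds ((hyperfilter ℕ).map D) (by
      rw [Ultrafilter.coe_map]
      exact tendsto_principal.2 (.of_forall hmem))
  refine ⟨(InnerProductSpace.toDual ℝ E).symm (WeakDual.toStrongDual ξ), fun z a ha => ?_⟩
  have h1 : Tendsto (fun k => D k z) (hyperfilter ℕ) (𝓝 (ξ z)) :=
    ((WeakDual.eval_continuous (𝕜 := ℝ) z).tendsto ξ).comp hξ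
  have h2 : Tendsto (fun k => D k z) (hyperfilter ℕ) (𝓝 a) :=
    ha.mono_left Nat.hyperfilter_le_atTop
  rw [InnerProductSpace.toDual_symm_apply]
  exact tendsto_nhds_unique h1 h2

lemma exists_weak_cluster {H : ℕ → Plane → ℝ} {C : NNReal} (hH : ∀ k, MemLp (H k) 2 volume)
    (hC : ∀ k, eLpNorm (H k) 2 volume ≤ C) :
    ∃ h, MemLp h 2 volume ∧ ∀ φ : Plane → ℝ, MemLp φ 2 volume → ∀ a : ℝ,
      Tendsto (fun k => ∫ x, H k x * φ x) atTop (𝓝 a) → ∫ x, h x * φ x = a := by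
  obtain ⟨h, hh⟩ := exists_weak_cluster_hilbert (x := fun k => (hH k).toLp (H k)) (C := C)
    fun k => by
      rw [Lp.norm_toLp]
      exact ENNReal.toReal_le_coe_of_le_coe (hC k)
  refine ⟨h, Lp.memLp h, fun φ hφ a ha => ?_⟩
  rw [← inner_toLp_toLp (Lp.memLp h) hφ, Lp.toLp_coeFn]
  refine hh _ _ (ha.congr fun k => ?_)
  rw [inner_toLp_toLp]

/-! ### Test functions -/

namespace IsTest

variable {U : Set Plane} {φ ψ : Plane → ℝ}

lemma mono (hφ : IsTest U φ) {V : Set Plane} (h : U ⊆ V) : IsTest V φ :=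
  ⟨hφ.1, hφ.2.1, hφ.2.2.trans h⟩

lemma univ (hφ : IsTest U φ) : IsTest Set.univ φ := hφ.mono (Set.subset_univ _)

lemma memLp (hφ : IsTest U φ) : MemLp φ 2 volume :=
  hφ.1.continuous.memLp_of_hasCompactSupport hφ.2.1

lemma fderiv_apply (hφ : IsTest U φ) (v : Plane) : IsTest U fun x => fderiv ℝ φ x v := by
  refine ⟨(hφ.1.fderiv_right (m := ∞) (by simp)).clm_apply contDiff_const, ?_, ?_⟩
  · exact hφ.2.1.fderiv_apply (𝕜 := ℝ) v
  · exact (tsupport_fderiv_apply_subset ℝ v).trans hφ.2.2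

end IsTest

/-! ### Difference quotients and weak derivatives -/

/-- The difference quotient of `f` in direction `v` with step `ℓ`. -/
def diffQuot (ℓ : ℝ) (v : Plane) (f : Plane → ℝ) : Plane → ℝ :=
  fun x => ℓ⁻¹ * (f (x + ℓ • v) - f x)

lemma memLp_comp_add_right {f : Plane → ℝ} (hf : MemLp f 2 volume) (a : Plane) :
    MemLp (fun x => f (x + a)) 2 volume :=
  hf.comp_measurePreserving (measurePreserving_add_right volume a)

lemma memLp_diffQuot {f : Plane → ℝ} (hf : MemLp f 2 volume) (ℓ : ℝ) (v : Plane) :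
    MemLp (diffQuot ℓ v f) 2 volume :=
  ((memLp_comp_add_right hf (ℓ • v)).sub hf).const_mul ℓ⁻¹

lemma integral_diffQuot_mul {f φ : Plane → ℝ} (hf : MemLp f 2 volume) (hφ : MemLp φ 2 volume)
    (ℓ : ℝ) (v : Plane) :
    ∫ x, diffQuot ℓ v f x * φ x = -∫ x, f x * diffQuot (-ℓ) v φ x := by
  have h1 : ∫ x, f (x + ℓ • v) * φ x = ∫ x, f x * φ (x + (-ℓ) • v) := by
    rw [← integral_add_right_eq_self (fun x => f x * φ (x + (-ℓ) • v)) (ℓ • v)]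
    simp
  have i1 := integrable_mul (memLp_comp_add_right hf (ℓ • v)) hφ
  have i2 := integrable_mul hf hφ
  have i3 := integrable_mul hf (memLp_comp_add_right hφ ((-ℓ) • v))
  have e1 : ∀ x, diffQuot ℓ v f x * φ x = ℓ⁻¹ * (f (x + ℓ • v) * φ x - f x * φ x) := fun x => by
    simp only [diffQuot]; ring
  have e2 : ∀ x, f x * diffQuot (-ℓ) v φ x =
      -ℓ⁻¹ * (f x * φ (x + (-ℓ) • v) - f x * φ x) := fun x => by
    simp only [diffQuot, inv_neg]; ring
  simp_rw [e1, e2]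
  rw [integral_const_mul, integral_const_mul, integral_sub i1 i2, integral_sub i3 i2, h1]
  ring

lemma IsTest.tendsto_diffQuot {φ : Plane → ℝ} (hφ : IsTest Set.univ φ) (v : Plane) {ℓ : ℕ → ℝ}
    (hℓ0 : ∀ k, ℓ k ≠ 0) (hℓ : Tendsto ℓ atTop (𝓝 0)) :
    Tendsto (fun k => eLpNorm (diffQuot (ℓ k) v φ - fun x => fderiv ℝ φ x v) 2 volume)
      atTop (𝓝 0) := by
  have hd : Differentiable ℝ φ := hφ.1.differentiable (by simp)
  obtain ⟨C, hC⟩ := hφ.1.lipschitzWith_of_hasCompactSupport hφ.2.1 (by simp)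
  obtain ⟨R, hR⟩ := hφ.2.1.isBounded.exists_norm_le
  have hR' : ∀ x, R < ‖x‖ → φ x = 0 := fun x hx =>
    image_eq_zero_of_notMem_tsupport fun h => absurd (hR x h) (not_le.2 hx)
  refine tendsto_eLpNorm_sub_of_bounded (M := C * ‖v‖) (R := R + ‖v‖)
    (fun k => ?_) (.of_forall fun k x => ?_) ?_ fun x => ?_
  · have := hφ.1.continuous
    unfold diffQuot
    fun_prop
  · rw [diffQuot, abs_mul, abs_inv, inv_mul_le_iff₀ (abs_pos.2 (hℓ0 k))]
    have := hC.dist_le_mul (x + ℓ k • v) x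
    rw [Real.dist_eq, dist_eq_norm, add_sub_cancel_left, norm_smul, Real.norm_eq_abs] at this
    linarith
  · have h1 : ∀ᶠ k in atTop, |ℓ k| < 1 := by
      have := hℓ.abs
      rw [abs_zero] at this
      exact this.eventually_lt_const one_pos
    filter_upwards [h1] with k hk x hx
    have h2 : ‖ℓ k • v‖ ≤ ‖v‖ := by
      rw [norm_smul, Real.norm_eq_abs]
      nlinarith [norm_nonneg v]
    have h3 : ‖x‖ ≤ ‖x + ℓ k • v‖ + ‖ℓ k • v‖ := norm_le_add_norm_add _ _
    rw [diffQuot, hR' x (by linarith [norm_nonneg v]), hR' (x + ℓ k • v) (by linarith)]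
    simp
  · have h1 : HasLineDerivAt ℝ φ (fderiv ℝ φ x v) x v := (hd x).hasFDerivAt.hasLineDerivAt v
    have h2 := hasDerivAt_iff_tendsto_slope_zero.1 h1
    have h3 : Tendsto ℓ atTop (𝓝[≠] 0) :=
      tendsto_nhdsWithin_iff.2 ⟨hℓ, .of_forall hℓ0⟩
    refine (h2.comp h3).congr fun k => ?_
    simp [diffQuot]

/-- A weak `L²` limit of functions whose difference quotients stay bounded in `L²` has a weak
directional derivative in `L²`, the weak limit of the difference quotients. -/
lemma exists_weak_deriv_of_diffQuot_bounded {G : ℕ → Plane → ℝ} {g : Plane → ℝ} {C C' : NNReal}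
    (v : Plane) {ℓ : ℕ → ℝ} (hℓ0 : ∀ k, ℓ k ≠ 0) (hℓ : Tendsto ℓ atTop (𝓝 0))
    (hG : ∀ k, MemLp (G k) 2 volume) (hC : ∀ k, eLpNorm (G k) 2 volume ≤ C)
    (hC' : ∀ k, eLpNorm (diffQuot (ℓ k) v (G k)) 2 volume ≤ C')
    (hGg : ∀ φ, IsTest Set.univ φ →
      Tendsto (fun k => ∫ x, G k x * φ x) atTop (𝓝 (∫ x, g x * φ x))) :
    ∃ h, MemLp h 2 volume ∧
      (∀ φ, IsTest Set.univ φ → Tendsto (fun k => ∫ x, diffQuot (ℓ k) v (G k) x * φ x) atTop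
        (𝓝 (∫ x, h x * φ x))) ∧
      ∀ φ, IsTest Set.univ φ → ∫ x, g x * fderiv ℝ φ x v = -∫ x, h x * φ x := by
  have key : ∀ φ, IsTest Set.univ φ →
      Tendsto (fun k => ∫ x, diffQuot (ℓ k) v (G k) x * φ x) atTop
        (𝓝 (-∫ x, g x * fderiv ℝ φ x v)) := by
    intro φ hφ
    simp_rw [fun k => integral_diffQuot_mul (hG k) hφ.memLp (ℓ k) v]
    refine (tendsto_integral_mul hG hC (fun k => memLp_diffQuot hφ.memLp _ _)
      (hφ.fderiv_apply v).memLp (hφ.tendsto_diffQuot v (fun k => neg_ne_zero.2 (hℓ0 k)) ?_)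
      (hGg _ (hφ.fderiv_apply v))).neg
    simpa using hℓ.neg
  obtain ⟨h, hh, hlim⟩ := exists_weak_cluster (fun k => memLp_diffQuot (hG k) (ℓ k) v) hC'
  have heq : ∀ φ, IsTest Set.univ φ → ∫ x, h x * φ x = -∫ x, g x * fderiv ℝ φ x v :=
    fun φ hφ => hlim φ hφ.memLp _ (key φ hφ)
  refine ⟨h, hh, fun φ hφ => ?_, fun φ hφ => ?_⟩
  · rw [heq φ hφ]; exact key φ hφ
  · rw [heq φ hφ, neg_neg]

/-! ### Uniform bounds along the sequence -/

/-- The scaled bounds on the nodal values of a displacement of lattice size `ℓ`: discrete `H²`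
bounds on the values `u` over `L₁(ℓ)`, bounds on `u` and its increments, and a bound on the
difference to the values `v` over `L₂(ℓ)`. -/
structure NodalBounds (C ℓ : ℝ) (u v : ℤ × ℤ → ℝ) : Prop where
  box : ∃ N : ℕ, BoxSupported N u ∧ BoxSupported N v ∧ ℓ * (N + 2) ≤ C
  second (i j : Fin 2) :
    sqSum (fwdDiff (bond j.castSucc) (fwdDiff (bond i.castSucc) u)) ≤ C * ℓ ^ 2
  first (i : Fin 2) : sqSum (fwdDiff (bond i.castSucc) u) ≤ C
  zeroth : ℓ ^ 2 * sqSum u ≤ C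
  increment (i : Fin 2) (n : ℤ × ℤ) (j : ℕ) :
    (u (n + j • bond i.castSucc) - u n) ^ 2 ≤ j * (C * ℓ)
  bounded (n : ℤ × ℤ) : u n ^ 2 ≤ C
  diff : sqSum (fun n => v n - u n) ≤ C

/-- Bounded energy gives nodal bounds with a constant independent of the lattice size. The side
of the supporting box, in lattice units, is `O(1/ℓ)`. -/
lemma exists_nodalBounds {Ω : Set Plane} {kZ kC τ₀ : ℝ} (hkZ : 0 < kZ) (hkC : 0 ≤ kC)
    (hτ₀ : τ₀ ≤ 0) {R L M : ℝ} (hR0 : 0 ≤ R) (hR : ∀ x ∈ Ω, ‖x‖ ≤ R) (hM0 : 0 ≤ M) :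
    ∃ C, 0 ≤ C ∧ ∀ ℓ, 0 < ℓ → ℓ ≤ L → ∀ w ∈ Admissible Ω ℓ, energy kZ kC τ₀ ℓ w ≤ M →
      NodalBounds C ℓ (fun n => w (node ℓ 0 n)) (fun n => w (node ℓ 1 n)) := by
  set A := 2 * R + 9 * |L| with hA
  set B := 3 * M / (2 * kZ) with hB
  have hA0 : 0 ≤ A := by positivity
  have hB0 : 0 ≤ B := by positivity
  refine ⟨A + 9 * B * (1 + A + A ^ 2 + A ^ 4), by positivity, fun ℓ hℓ hℓL w hw hE => ?_⟩
  set C := A + 9 * B * (1 + A + A ^ 2 + A ^ 4) with hC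
  have hCe : C = A + 9 * B + 9 * B * A + 9 * B * A ^ 2 + 9 * B * A ^ 4 := by rw [hC]; ring
  clear_value C
  have hp1 : 0 ≤ 9 * B * A := by positivity
  have hp2 : 0 ≤ 9 * B * A ^ 2 := by positivity
  have hp4 : 0 ≤ 9 * B * A ^ 4 := by positivity
  obtain ⟨N, hN, hN'⟩ : ∃ N : ℕ, R / ℓ + 1 ≤ N ∧ (N : ℝ) < R / ℓ + 1 + 1 :=
    ⟨_, Nat.le_ceil _, Nat.ceil_lt_add_one (by positivity)⟩
  have hu := Admissible.boxSupported hℓ hw hR hN 0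
  have hv := Admissible.boxSupported hℓ hw hR hN 1
  have hNl : ℓ * N ≤ R + 2 * ℓ := by
    have : ℓ * N ≤ ℓ * (R / ℓ + 1 + 1) := by gcongr
    refine this.trans (le_of_eq ?_)
    field_simp; ring
  have hL : ℓ ≤ |L| := hℓL.trans (le_abs_self L)
  obtain ⟨K, hK⟩ : ∃ K : ℕ, K = 2 * N + 5 := ⟨_, rfl⟩
  have hKA : ℓ * K ≤ A := by
    rw [hK]; push_cast; linarith
  have hKA2 : (ℓ * K) ^ 2 ≤ A ^ 2 := by gcongr
  have hKA4 : (ℓ * K) ^ 4 ≤ A ^ 4 := by gcongr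
  obtain ⟨h2, h1, hi, hb, h0, hd⟩ := coercivity hu hv
    (fun i j hij => sqSum_zig_le hkZ hkC hτ₀ hℓ hE hu hv hij) hK.ge
  rw [← hB] at *
  have hBA2 : (K : ℝ) ^ 2 * (9 * (B * ℓ ^ 2)) ≤ C := by
    have h3 : 9 * B * (ℓ * K) ^ 2 ≤ 9 * B * A ^ 2 := by gcongr
    have e : (K : ℝ) ^ 2 * (9 * (B * ℓ ^ 2)) = 9 * B * (ℓ * K) ^ 2 := by ring
    linarith
  refine ⟨⟨N, hu, hv, by rw [mul_add]; linarith⟩, fun i j => (h2 i j).trans ?_,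
    fun i => (h1 i).trans hBA2, ?_, fun i n j => (hi i n j).trans ?_,
    fun n => (hb n).trans hBA2, hd.trans ?_⟩
  · rw [← mul_assoc]
    exact mul_le_mul_of_nonneg_right (by linarith) (sq_nonneg ℓ)
  · have e : ℓ ^ 2 * ((K : ℝ) ^ 2 * ((K : ℝ) ^ 2 * (9 * (B * ℓ ^ 2)))) = 9 * B * (ℓ * K) ^ 4 := by
      ring
    have : 9 * B * (ℓ * K) ^ 4 ≤ 9 * B * A ^ 4 := by gcongr
    have h3 := mul_le_mul_of_nonneg_left h0 (sq_nonneg ℓ)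
    rw [e] at h3
    linarith
  · have h3 : 9 * B * (ℓ * K) ≤ 9 * B * A := by gcongr
    refine mul_le_mul_of_nonneg_left ?_ j.cast_nonneg
    have e : (K : ℝ) * (9 * (B * ℓ ^ 2)) = 9 * B * (ℓ * K) * ℓ := by ring
    rw [e]
    exact mul_le_mul_of_nonneg_right (by linarith) hℓ.le
  · have : (0 : ℝ) ≤ K ^ 2 * (B * ℓ ^ 2) := by positivity
    linarith

/-! ### Compactness -/

/-- The Arzelà–Ascoli argument for functions that are equicontinuous only up to an error tending
to zero along the sequence; it gives pointwise convergence. -/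
lemma exists_subseq_tendsto_of_almost_equicontinuous {X : Type*} [PseudoMetricSpace X]
    [TopologicalSpace.SeparableSpace X] [Nonempty X] {F : ℕ → X → ℝ} {M C : ℝ} {ε : ℕ → ℝ}
    (hM : ∀ k x, |F k x| ≤ M) (hε : Tendsto ε atTop (𝓝 0))
    (hF : ∀ k x y, (F k x - F k y) ^ 2 ≤ C * (dist x y + ε k)) :
    ∃ (σ : ℕ → ℕ) (g : X → ℝ), StrictMono σ ∧
      ∀ x, Tendsto (fun k => F (σ k) x) atTop (𝓝 (g x)) := by
  set q := TopologicalSpace.denseSeq X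
  have hcpt : IsCompact (Set.univ.pi fun _ : ℕ => Set.Icc (-M) M) :=
    isCompact_univ_pi fun _ => isCompact_Icc
  obtain ⟨a, -, σ, hσ, ha⟩ := hcpt.tendsto_subseq (x := fun k i => F k (q i))
    fun k i _ => abs_le.1 (hM k (q i))
  rw [tendsto_pi_nhds] at ha
  have hcau : ∀ x, ∃ b, Tendsto (fun k => F (σ k) x) atTop (𝓝 b) := by
    intro x
    refine cauchySeq_tendsto_of_complete (Metric.cauchySeq_iff'.2 fun e he => ?_)
    set δ := (e / 4) ^ 2 / (2 * (|C| + 1)) with hδ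
    have hδ0 : 0 < δ := by positivity
    obtain ⟨i, hi⟩ := Metric.denseRange_iff.1 (TopologicalSpace.denseRange_denseSeq X) x δ hδ0
    have hsmall : ∀ᶠ k in atTop, |F (σ k) x - F (σ k) (q i)| < e / 4 := by
      have h1 : ∀ᶠ k in atTop, |ε (σ k)| < δ := by
        have := (hε.comp hσ.tendsto_atTop).abs
        rw [abs_zero] at this
        exact this.eventually_lt_const hδ0
      filter_upwards [h1] with k hk
      refine abs_lt_of_sq_lt_sq ((hF (σ k) x (q i)).trans_lt ?_) (by positivity)
      have h2 : C * (dist x (q i) + ε (σ k)) ≤ |C| * (δ + δ) := by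
        refine (le_abs_self _).trans ?_
        rw [abs_mul]
        refine mul_le_mul_of_nonneg_left ((abs_add_le _ _).trans ?_) (abs_nonneg C)
        rw [abs_of_nonneg dist_nonneg]
        exact add_le_add (le_of_lt hi) hk.le
      have h3 : (2 * (|C| + 1)) * δ = (e / 4) ^ 2 := by rw [hδ]; field_simp
      nlinarith [abs_nonneg C]
    have hq : ∀ᶠ k in atTop, |F (σ k) (q i) - a i| < e / 4 :=
      Metric.tendsto_nhds.1 (ha i) (e / 4) (by positivity)
    obtain ⟨n, hn⟩ := eventually_atTop.1 (hsmall.and hq)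
    refine ⟨n, fun m hm => ?_⟩
    obtain ⟨m1, m2⟩ := hn m hm
    obtain ⟨n1, n2⟩ := hn n le_rfl
    rw [Real.dist_eq]
    rw [abs_lt] at *
    constructor <;> linarith
  choose g hg using hcau
  exact ⟨σ, g, hσ, hg⟩

section Cell

variable {u : ℤ × ℤ → ℝ} {B ℓ : ℝ}

/-- Increments along both lattice directions are combined through one intermediate point. -/
lemma sq_sub_le_of_increment
    (h : ∀ (i : Fin 2) (n : ℤ × ℤ) (j : ℕ), (u (n + j • bond i.castSucc) - u n) ^ 2 ≤ j * B)
    (m n : ℤ × ℤ) :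
    (u m - u n) ^ 2 ≤ 2 * B * (|((m.1 - n.1 : ℤ) : ℝ)| + |((m.2 - n.2 : ℤ) : ℝ)|) := by
  have hz : ∀ (i : Fin 2) (n : ℤ × ℤ) (z : ℤ),
      (u (n + z • bond i.castSucc) - u n) ^ 2 ≤ |(z : ℝ)| * B := by
    intro i n z
    obtain ⟨j, rfl | rfl⟩ := z.eq_nat_or_neg
    · simpa only [natCast_zsmul, Int.cast_natCast, Nat.abs_cast] using h i n j
    · have h1 := h i (n + (-(j : ℤ)) • bond i.castSucc) j
      rw [neg_smul, natCast_zsmul, neg_add_cancel_right, ← neg_sub, neg_sq] at h1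
      rw [neg_smul, natCast_zsmul]
      simpa only [Int.cast_neg, abs_neg, Int.cast_natCast, Nat.abs_cast] using h1
  have h0 := hz 0 n (m.1 - n.1)
  have h1 := hz 1 (n + (m.1 - n.1) • bond (0 : Fin 2).castSucc) (m.2 - n.2)
  have e : n + (m.1 - n.1) • bond (0 : Fin 2).castSucc + (m.2 - n.2) • bond (1 : Fin 2).castSucc
      = m := by
    ext <;> simp [bond]
  rw [e] at h1
  nlinarith [sq_nonneg ((u m - u (n + (m.1 - n.1) • bond (0 : Fin 2).castSucc)) -
    (u (n + (m.1 - n.1) • bond (0 : Fin 2).castSucc) - u n))]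

lemma sq_sub_cell_le (hℓ : 0 < ℓ) {C : ℝ} (hC : 0 ≤ C)
    (h : ∀ (i : Fin 2) (n : ℤ × ℤ) (j : ℕ),
      (u (n + j • bond i.castSucc) - u n) ^ 2 ≤ j * (C * ℓ)) (x y : Plane) :
    (u (cell ℓ x) - u (cell ℓ y)) ^ 2 ≤ 4 * C * (dist x y + ℓ) := by
  have hfl : ∀ i : Fin 2, |((⌊latCoord i x / ℓ + 1 / 3⌋ - ⌊latCoord i y / ℓ + 1 / 3⌋ : ℤ) : ℝ)| ≤
      dist x y / ℓ + 1 := by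
    intro i
    have h1 := abs_le.1 (abs_latCoord_le i (x - y))
    rw [map_sub, ← dist_eq_norm] at h1
    have h2 := div_le_div_of_nonneg_right h1.1 hℓ.le
    have h3 := div_le_div_of_nonneg_right h1.2 hℓ.le
    rw [neg_div, sub_div] at h2
    rw [sub_div] at h3
    have a1 := Int.floor_le (latCoord i x / ℓ + 1 / 3)
    have a2 := Int.lt_floor_add_one (latCoord i x / ℓ + 1 / 3)
    have b1 := Int.floor_le (latCoord i y / ℓ + 1 / 3)
    have b2 := Int.lt_floor_add_one (latCoord i y / ℓ + 1 / 3)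
    rw [abs_le]
    push_cast
    constructor <;> linarith
  refine (sq_sub_le_of_increment h _ _).trans ?_
  have h0 := hfl 0
  have h1 := hfl 1
  have hle : 2 * (C * ℓ) * (|(((cell ℓ x).1 - (cell ℓ y).1 : ℤ) : ℝ)| +
      |(((cell ℓ x).2 - (cell ℓ y).2 : ℤ) : ℝ)|) ≤
      2 * (C * ℓ) * ((dist x y / ℓ + 1) + (dist x y / ℓ + 1)) := by
    gcongr <;> assumption
  refine hle.trans (le_of_eq ?_)
  field_simp
  ring

lemma comp_cell_eq_zero (hℓ : 0 < ℓ) {N : ℕ} (hu : BoxSupported N u) {x : Plane}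
    (hx : 4 * (ℓ * (N + 2)) < ‖x‖) : u (cell ℓ x) = 0 := by
  by_contra h
  obtain ⟨h1, h2⟩ := hu _ h
  obtain ⟨⟨a1, a2⟩, b1, b2⟩ := cell_spec ℓ x
  have key : ∀ (i : Fin 2) (k : ℤ), |k| ≤ N → 0 ≤ latCoord i x / ℓ + 1 / 3 - k →
      latCoord i x / ℓ + 1 / 3 - k < 1 → |latCoord i x| ≤ ℓ * (N + 2) := by
    intro i k hk c1 c2
    have hk' : |(k : ℝ)| ≤ N := by exact_mod_cast hk
    rw [abs_le] at hk'
    have h3 : |latCoord i x / ℓ| ≤ N + 2 := by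
      rw [abs_le]; constructor <;> linarith
    rwa [abs_div, abs_of_pos hℓ, div_le_iff₀ hℓ, mul_comm] at h3
  have k0 := key 0 _ h1 a1 a2
  have k1 := key 1 _ h2 b1 b2
  linarith [norm_le_latCoord x]

lemma measurable_comp_cell (u : ℤ × ℤ → ℝ) (ℓ : ℝ) : Measurable fun x => u (cell ℓ x) :=
  (measurable_of_countable u).comp (measurable_cell ℓ)

lemma eLpNorm_comp_cell_le (hℓ : 0 < ℓ) (hu : Summable fun n => u n ^ 2) (s : ℝ) {C : ℝ}
    (h : ℓ ^ 2 * s ^ 2 * sqSum u ≤ C) :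
    eLpNorm (fun x => s * u (cell ℓ x)) 2 volume ≤ ((√(cellArea * C)).toNNReal : NNReal) := by
  have hC : 0 ≤ C := le_trans (mul_nonneg (by positivity) (tsum_nonneg fun _ => sq_nonneg _)) h
  have h1 : eLpNorm (fun x => s * u (cell ℓ x)) 2 volume ^ 2 ≤
      ((√(cellArea * C)).toNNReal : ENNReal) ^ 2 := by
    rw [eLpNorm_two_sq]
    have e : ∀ x, ‖s * u (cell ℓ x)‖ₑ ^ 2 = ENNReal.ofReal ((fun n => s * u n) (cell ℓ x) ^ 2) := by
      intro x
      rw [← ofReal_norm, ← ENNReal.ofReal_pow (norm_nonneg _), Real.norm_eq_abs, sq_abs]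
    simp_rw [e]
    have hs : Summable fun n => (s * u n) ^ 2 := by
      simp_rw [mul_pow]; exact hu.mul_left _
    refine (lintegral_cell_le hℓ hs).trans ?_
    change _ ≤ ENNReal.ofReal (√(cellArea * C)) ^ 2
    rw [← ENNReal.ofReal_pow (Real.sqrt_nonneg _),
      Real.sq_sqrt (mul_nonneg cellArea_nonneg hC)]
    refine ENNReal.ofReal_le_ofReal ?_
    have e2 : sqSum (fun n => s * u n) = s ^ 2 * sqSum u := by
      simp only [sqSum, mul_pow, tsum_mul_left]
    rw [e2]
    nlinarith [mul_le_mul_of_nonneg_left h cellArea_nonneg]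
  exact (ENNReal.pow_le_pow_left_iff two_ne_zero).1 h1

end Cell

lemma memLp_of_tendsto {f : ℕ → Plane → ℝ} {g : Plane → ℝ} (hf : ∀ k, MemLp (f k) 2 volume)
    (hg : AEStronglyMeasurable g volume)
    (h : Tendsto (fun k => eLpNorm (f k - g) 2 volume) atTop (𝓝 0)) : MemLp g 2 volume := by
  obtain ⟨k, hk⟩ := (h.eventually_lt_const one_pos).exists
  have h1 : MemLp (f k - g) 2 volume := ⟨(hf k).1.sub hg, hk.trans ENNReal.one_lt_top⟩
  have h2 := (hf k).sub h1
  rwa [sub_sub_cancel] at h2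

/-- Compactness of the piecewise constant functions that take the values of `u` on the cells. -/
lemma exists_subseq_comp_cell_tendsto {C : ℝ} (hC : 0 ≤ C) {ℓ : ℕ → ℝ} (hℓ0 : ∀ k, 0 < ℓ k)
    (hℓ : Tendsto ℓ atTop (𝓝 0)) {u v : ℕ → ℤ × ℤ → ℝ}
    (h : ∀ k, NodalBounds C (ℓ k) (u k) (v k)) :
    ∃ (σ : ℕ → ℕ) (g : Plane → ℝ), StrictMono σ ∧ Measurable g ∧
      Tendsto (fun k => eLpNorm ((fun x => u (σ k) (cell (ℓ (σ k)) x)) - g) 2 volume)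
        atTop (𝓝 0) := by
  have hM : ∀ k n, |u k n| ≤ √C := fun k n => by
    rw [← Real.sqrt_sq_eq_abs]
    exact Real.sqrt_le_sqrt ((h k).bounded n)
  obtain ⟨σ, g, hσ, hg⟩ := exists_subseq_tendsto_of_almost_equicontinuous
    (F := fun k x => u k (cell (ℓ k) x)) (M := √C) (C := 4 * C) (ε := ℓ)
    (fun k x => hM k _) hℓ fun k x y => sq_sub_cell_le (hℓ0 k) hC (h k).increment x y
  refine ⟨σ, g, hσ, measurable_of_tendsto_metrizable
    (fun k => measurable_comp_cell (u (σ k)) (ℓ (σ k))) (tendsto_pi_nhds.2 hg), ?_⟩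
  refine tendsto_eLpNorm_sub_of_bounded (M := √C) (R := 4 * C)
    (fun k => measurable_comp_cell (u (σ k)) (ℓ (σ k))) (.of_forall fun k x => hM _ _)
    (.of_forall fun k x hx => ?_) hg
  obtain ⟨N, hN, -, hNC⟩ := (h (σ k)).box
  exact comp_cell_eq_zero (hℓ0 _) hN (by linarith)

/-- The displacements are close in `L²` to the piecewise constant functions that only see the
sublattice `L₁(ℓ)`. -/
lemma tendsto_eLpNorm_sub_comp_cell {Ω : Set Plane} {C : ℝ} {ℓ : ℕ → ℝ}
    (hℓ0 : ∀ k, 0 < ℓ k) (hℓ : Tendsto ℓ atTop (𝓝 0)) {w : ℕ → Plane → ℝ}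
    (hw : ∀ k, w k ∈ Admissible Ω (ℓ k))
    (h : ∀ k, NodalBounds C (ℓ k) (fun n => w k (node (ℓ k) 0 n))
      (fun n => w k (node (ℓ k) 1 n))) :
    Tendsto (fun k => eLpNorm (w k - fun x => w k (node (ℓ k) 0 (cell (ℓ k) x))) 2 volume)
      atTop (𝓝 0) := by
  refine tendsto_eLpNorm_two ?_
  have hlim : Tendsto (fun k => ENNReal.ofReal (ℓ k ^ 2 * cellArea * C)) atTop (𝓝 0) := by
    have : Tendsto (fun k => ℓ k ^ 2 * cellArea * C) atTop (𝓝 0) := by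
      simpa using ((hℓ.pow 2).mul_const cellArea).mul_const C
    simpa using ENNReal.tendsto_ofReal this
  refine tendsto_of_tendsto_of_tendsto_of_le_of_le tendsto_const_nhds hlim
    (fun _ => zero_le) fun k => ?_
  obtain ⟨N, hu, hv, -⟩ := (h k).box
  refine le_trans (lintegral_mono_ae ?_)
    ((lintegral_cell_le (hℓ0 k) (hv.sub hu).summable_sq).trans (ENNReal.ofReal_le_ofReal ?_))
  · filter_upwards [Admissible.ae_eq (hℓ0 k) (hw k)] with x hx
    rw [Pi.sub_apply, ← ofReal_norm, ← ENNReal.ofReal_pow (norm_nonneg _), Real.norm_eq_abs, sq_abs]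
    refine ENNReal.ofReal_le_ofReal ?_
    rcases hx with hx | hx <;> rw [hx]
    simpa using sq_nonneg _
  · exact mul_le_mul_of_nonneg_left (h k).diff (mul_nonneg (sq_nonneg _) cellArea_nonneg)

/-! ### The limit is in `H²` -/

/-- Weak derivatives along the lattice vectors give weak partial derivatives. -/
lemma isWeakPartial_of_latVec {f : Plane → ℝ} {G : Fin 2 → Plane → ℝ} (hf : MemLp f 2 volume)
    (hG : ∀ a, MemLp (G a) 2 volume)
    (h : ∀ a φ, IsTest Set.univ φ →
      ∫ x, f x * fderiv ℝ φ x (latVec a) = -∫ x, G a x * φ x) (i : Fin 2) :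
    IsWeakPartial Set.univ i f
      (fun x => ∑ a, latCoord a (EuclideanSpace.single i 1) * G a x) := by
  intro φ hφ
  set e : Plane := EuclideanSpace.single i 1 with he
  have he' : e = latCoord 0 e • latVec 0 + latCoord 1 e • latVec 1 :=
    (sum_latCoord_smul e).symm
  have e1 : ∀ x, f x * partialD i φ x = latCoord 0 e * (f x * fderiv ℝ φ x (latVec 0)) +
      latCoord 1 e * (f x * fderiv ℝ φ x (latVec 1)) := by
    intro x
    rw [partialD, ← he]
    conv_lhs => rw [he']
    rw [map_add, map_smul, map_smul, smul_eq_mul, smul_eq_mul]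
    ring
  have e2 : ∀ x, (∑ a, latCoord a e * G a x) * φ x =
      latCoord 0 e * (G 0 x * φ x) + latCoord 1 e * (G 1 x * φ x) := by
    intro x
    rw [Fin.sum_univ_two]
    ring
  have i1 : ∀ a, Integrable fun x => f x * fderiv ℝ φ x (latVec a) :=
    fun a => integrable_mul hf (hφ.fderiv_apply _).memLp
  have i2 : ∀ a, Integrable fun x => G a x * φ x := fun a => integrable_mul (hG a) hφ.memLp
  simp_rw [setIntegral_univ, e1, e2]
  rw [integral_add ((i1 0).const_mul _) ((i1 1).const_mul _),
    integral_add ((i2 0).const_mul _) ((i2 1).const_mul _)]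
  simp_rw [integral_const_mul, h _ φ hφ]
  ring

lemma isWeakPartial_sum {ι : Type*} [Fintype ι] {U : Set Plane} {i : Fin 2} (c : ι → ℝ)
    {f g : ι → Plane → ℝ}
    (hf : ∀ a, MemLp (f a) 2 (volume.restrict U)) (hg : ∀ a, MemLp (g a) 2 (volume.restrict U))
    (h : ∀ a, IsWeakPartial U i (f a) (g a)) :
    IsWeakPartial U i (fun x => ∑ a, c a * f a x) (fun x => ∑ a, c a * g a x) := by
  intro φ hφ
  have ht : MemLp (partialD i φ) 2 (volume.restrict U) := (hφ.fderiv_apply _).memLp.restrict U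
  have hs : MemLp φ 2 (volume.restrict U) := hφ.memLp.restrict U
  simp_rw [Finset.sum_mul, mul_assoc]
  have i1 : ∀ a ∈ Finset.univ, Integrable (fun x => c a * (f a x * partialD i φ x))
      (volume.restrict U) := fun a _ => ((hf a).integrable_mul ht).const_mul (c a)
  have i2 : ∀ a ∈ Finset.univ, Integrable (fun x => c a * (g a x * φ x))
      (volume.restrict U) := fun a _ => ((hg a).integrable_mul hs).const_mul (c a)
  rw [integral_finsetSum _ i1, integral_finsetSum _ i2, ← Finset.sum_neg_distrib]
  refine Finset.sum_congr rfl fun a _ => ?_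
  rw [integral_const_mul, integral_const_mul, h a φ hφ, mul_neg]

/-- The prefactor `s` makes the statement iterable for second difference quotients. -/
lemma diffQuot_comp_cell {ℓ : ℝ} (hℓ : ℓ ≠ 0) (u : ℤ × ℤ → ℝ) (s : ℝ) (i : Fin 2) :
    diffQuot ℓ (latVec i) (fun x => s * u (cell ℓ x)) =
      fun x => ℓ⁻¹ * s * fwdDiff (bond i.castSucc) u (cell ℓ x) := by
  ext x
  simp only [diffQuot, fwdDiff, cell_add ℓ hℓ]
  ring

/-- The difference quotients with step `ℓ` along the lattice vectors are the scaled finite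
differences, so that the limit inherits the discrete `H²` bounds. -/
lemma memH2_of_comp_cell_tendsto {C : ℝ} {ℓ : ℕ → ℝ} (hℓ0 : ∀ k, 0 < ℓ k)
    (hℓ : Tendsto ℓ atTop (𝓝 0)) {u v : ℕ → ℤ × ℤ → ℝ}
    (h : ∀ k, NodalBounds C (ℓ k) (u k) (v k)) {g : Plane → ℝ} (hg : Measurable g)
    (hlim : Tendsto (fun k => eLpNorm ((fun x => u k (cell (ℓ k) x)) - g) 2 volume)
      atTop (𝓝 0)) :
    MemH2 Set.univ g := by
  set F : ℕ → Plane → ℝ := fun k x => 1 * u k (cell (ℓ k) x) with hFdef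
  have hF' : ∀ k, (fun x => u k (cell (ℓ k) x)) = F k := fun k => by simp [hFdef]
  simp_rw [hF'] at hlim
  have hbox : ∀ k, ∃ N, BoxSupported N (u k) := fun k => let ⟨N, hN, _⟩ := (h k).box; ⟨N, hN⟩
  choose N hN using hbox
  have hb : ∀ i : Fin 2, |(bond i.castSucc).1| ≤ 1 ∧ |(bond i.castSucc).2| ≤ 1 := by decide
  have hN1 : ∀ k i, BoxSupported (N k + 1) (fwdDiff (bond (Fin.castSucc i)) (u k)) :=
    fun k i => (hN k).fwdDiff (hb i).1 (hb i).2
  have hN2 : ∀ k i j, BoxSupported (N k + 1 + 1)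
      (fwdDiff (bond (Fin.castSucc j)) (fwdDiff (bond (Fin.castSucc i)) (u k))) :=
    fun k i j => (hN1 k i).fwdDiff (hb j).1 (hb j).2
  set D : NNReal := (√(cellArea * C)).toNNReal
  have hF0 : ∀ k, eLpNorm (F k) 2 volume ≤ D := fun k =>
    eLpNorm_comp_cell_le (hℓ0 k) (hN k).summable_sq 1 (by simpa using (h k).zeroth)
  have hF1 : ∀ i k, eLpNorm (diffQuot (ℓ k) (latVec i) (F k)) 2 volume ≤ D := fun i k => by
    rw [diffQuot_comp_cell (hℓ0 k).ne']
    refine eLpNorm_comp_cell_le (hℓ0 k) (hN1 k i).summable_sq _ ?_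
    have hne := (hℓ0 k).ne'
    refine le_trans (le_of_eq ?_) ((h k).first i)
    field_simp
  have hF2 : ∀ i j k, eLpNorm (diffQuot (ℓ k) (latVec j) (diffQuot (ℓ k) (latVec i) (F k)))
      2 volume ≤ D := fun i j k => by
    rw [diffQuot_comp_cell (hℓ0 k).ne', diffQuot_comp_cell (hℓ0 k).ne']
    refine eLpNorm_comp_cell_le (hℓ0 k) (hN2 k i j).summable_sq _ ?_
    have hne := (hℓ0 k).ne'
    have hs := mul_le_mul_of_nonneg_left ((h k).second i j)
      (by positivity : 0 ≤ ℓ k ^ 2 * ((ℓ k)⁻¹ * ((ℓ k)⁻¹ * 1)) ^ 2)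
    refine hs.trans (le_of_eq ?_)
    field_simp
  have hFm : ∀ k, MemLp (F k) 2 volume := fun k =>
    ⟨((measurable_comp_cell (u k) (ℓ k)).const_mul 1).aestronglyMeasurable,
      (hF0 k).trans_lt ENNReal.coe_lt_top⟩
  have hgm : MemLp g 2 volume := memLp_of_tendsto hFm hg.aestronglyMeasurable hlim
  have hweak : ∀ φ, IsTest Set.univ φ →
      Tendsto (fun k => ∫ x, F k x * φ x) atTop (𝓝 (∫ x, g x * φ x)) := by
    intro φ hφ
    have h1 : Tendsto (fun _ : ℕ => ∫ x, φ x * g x) atTop (𝓝 (∫ x, φ x * g x)) :=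
      tendsto_const_nhds
    have h2 := tendsto_integral_mul (G := fun _ => φ) (C := (eLpNorm φ 2 volume).toNNReal)
      (fun _ => hφ.memLp) (fun _ => (ENNReal.coe_toNNReal hφ.memLp.2.ne).ge) hFm hgm hlim h1
    simpa only [mul_comm] using h2
  have hne : ∀ k, ℓ k ≠ 0 := fun k => (hℓ0 k).ne'
  choose G hGm hGlim hG using fun i =>
    exists_weak_deriv_of_diffQuot_bounded (latVec i) hne hℓ hFm hF0 (hF1 i) hweak
  choose H hHm _ hH using fun i j => exists_weak_deriv_of_diffQuot_bounded (latVec j) hne hℓ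
    (fun k => memLp_diffQuot (hFm k) (ℓ k) (latVec i)) (hF1 i) (hF2 i j) (hGlim i)
  set c : Fin 2 → Fin 2 → ℝ := fun i a => latCoord a (EuclideanSpace.single i 1)
  have hsum : ∀ (c : Fin 2 → ℝ) (f : Fin 2 → Plane → ℝ), (∀ a, MemLp (f a) 2 volume) →
      MemLp (fun x => ∑ a, c a * f a x) 2 volume := fun c f hf =>
    memLp_finsetSum _ fun a _ => (hf a).const_mul (c a)
  refine ⟨fun i x => ∑ a, c i a * G a x, fun i j x => ∑ a, c i a * ∑ b, c j b * H a b x, ?_,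
    fun i => ⟨?_, ?_⟩, fun i j => ⟨?_, ?_⟩⟩
  · rwa [Measure.restrict_univ]
  · rw [Measure.restrict_univ]
    exact hsum _ _ hGm
  · exact isWeakPartial_of_latVec hgm hGm hG i
  · rw [Measure.restrict_univ]
    exact hsum _ _ fun a => hsum _ _ (hHm a)
  · refine isWeakPartial_sum _ (fun a => ?_) (fun a => ?_) fun a =>
      isWeakPartial_of_latVec (hGm a) (hHm a) (hH a) j
    · rw [Measure.restrict_univ]; exact hGm a
    · rw [Measure.restrict_univ]; exact hsum _ _ (hHm a)

/-! ### Mollification -/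

/-- The convolution of `f` with the kernel `ρ`. -/
def mollify (ρ f : Plane → ℝ) (x : Plane) : ℝ := ∫ t, f t * ρ (x - t)

lemma mollify_eq_convolution (ρ f : Plane → ℝ) :
    mollify ρ f = convolution f ρ (ContinuousLinearMap.lsmul ℝ ℝ) volume := by
  ext x
  simp [mollify, convolution_def]

lemma mollify_eq (ρ f : Plane → ℝ) (x : Plane) : mollify ρ f x = ∫ t, f (x - t) * ρ t := by
  rw [mollify, ← integral_sub_left_eq_self _ volume x]
  simp

lemma contDiff_mollify {ρ f : Plane → ℝ} (hρ : IsTest Set.univ ρ) (hf : MemLp f 2 volume) :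
    ContDiff ℝ ∞ (mollify ρ f) := by
  rw [mollify_eq_convolution]
  exact hρ.2.1.contDiff_convolution_right _ (hf.locallyIntegrable (by norm_num)) hρ.1

lemma IsTest.comp_sub_left {ρ : Plane → ℝ} (hρ : IsTest Set.univ ρ) (x : Plane) :
    IsTest Set.univ fun t => ρ (x - t) :=
  ⟨hρ.1.comp (contDiff_const.sub contDiff_id), hρ.2.1.comp_homeomorph (Homeomorph.subLeft x),
    Set.subset_univ _⟩

/-- Mollification turns weak partial derivatives into classical ones. -/
lemma partialD_mollify {ρ f g : Plane → ℝ} (hρ : IsTest Set.univ ρ) (hf : MemLp f 2 volume)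
    {i : Fin 2} (h : IsWeakPartial Set.univ i f g) :
    partialD i (mollify ρ f) = mollify ρ g := by
  ext x
  have hloc : LocallyIntegrable f volume := hf.locallyIntegrable (by norm_num)
  have h1 := hρ.2.1.hasFDerivAt_convolution_right (ContinuousLinearMap.lsmul ℝ ℝ) hloc
    (hρ.1.of_le (by simp)) x
  rw [partialD, mollify_eq_convolution, h1.fderiv,
    convolution_precompR_apply _ hloc (hρ.2.1.fderiv (𝕜 := ℝ))
      (hρ.1.continuous_fderiv (by simp))]
  have h2 := h _ (hρ.comp_sub_left x)
  simp_rw [setIntegral_univ] at h2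
  have h3 : ∀ t, partialD i (fun t => ρ (x - t)) t =
      -fderiv ℝ ρ (x - t) (EuclideanSpace.single i 1) := by
    intro t
    have hd : DifferentiableAt ℝ ρ (x - t) := hρ.1.differentiable (by simp) _
    have := hd.hasFDerivAt.comp t ((hasFDerivAt_id t).const_sub x)
    rw [partialD]
    erw [this.fderiv]
    simp
  simp_rw [h3, mul_neg, integral_neg, neg_inj] at h2
  rw [mollify, ← h2]
  simp [convolution_def]

/-- Continuity of translations in `L²`. -/
lemma tendsto_eLpNorm_translate {f : Plane → ℝ} (hf : MemLp f 2 volume) :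
    Tendsto (fun a : Plane => eLpNorm ((fun x => f (x - a)) - f) 2 volume) (𝓝 0) (𝓝 0) := by
  have hm : ∀ a : Plane, MeasurePreserving (fun x => x - a) volume volume :=
    fun a => measurePreserving_sub_right volume a
  refine (Lp.tendsto_Lp_iff_tendsto_eLpNorm'' (fun a x => f (x - a))
    (fun a => hf.comp_measurePreserving (hm a)) f hf).1 ?_
  set g : C(Plane, C(Plane, Plane)) :=
    (ContinuousMap.mk (fun q : Plane × Plane => q.2 - q.1) (by fun_prop)).curry
  have hg : ∀ a, MeasurePreserving (g a) volume volume := hm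
  have h := Filter.Tendsto.compMeasurePreservingLp (p := 2) (f := fun _ : Plane => hf.toLp f)
    (g := g) (g₀ := g 0) (tendsto_const_nhds (x := hf.toLp f) (f := 𝓝 (0 : Plane)))
    (g.continuous.tendsto 0) hg (hg 0) (by norm_num)
  have e : Lp.compMeasurePreserving (g 0) (hg 0) (hf.toLp f) = hf.toLp f :=
    (Lp.toLp_compMeasurePreserving hf (hg 0)).trans
      (MemLp.toLp_congr _ _ (.of_forall fun x => by simp [g]))
  rw [e] at h
  exact h

/-- Mollification moves `f` in `L²` no further than the translations by points of the support of
the kernel. -/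
lemma eLpNorm_mollify_sub_le_of_measurable {ρ f : Plane → ℝ} (hρ : IsTest Set.univ ρ)
    (hρ0 : ∀ x, 0 ≤ ρ x) (hρ1 : ∫ x, ρ x = 1) (hf : MemLp f 2 volume) (hfm : Measurable f)
    {ε : ENNReal}
    (hε : ∀ a, ρ a ≠ 0 → eLpNorm ((fun x => f (x - a)) - f) 2 volume ≤ ε) :
    eLpNorm (mollify ρ f - f) 2 volume ≤ ε := by
  have hρm : Measurable fun t => ENNReal.ofReal (ρ t) := hρ.1.continuous.measurable.ennreal_ofReal
  have hρi : Integrable ρ volume := hρ.1.continuous.integrable_of_hasCompactSupport hρ.2.1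
  set ν := volume.withDensity fun t => ENNReal.ofReal (ρ t) with hν
  have hmass : ∫⁻ t, ENNReal.ofReal (ρ t) = 1 := by
    rw [← ofReal_integral_eq_lintegral_ofReal hρi (.of_forall hρ0), hρ1, ENNReal.ofReal_one]
  have : IsProbabilityMeasure ν := ⟨by rw [hν, withDensity_apply _ .univ]; simpa using hmass⟩
  have hmeas : Measurable fun q : Plane × Plane => ‖f (q.1 - q.2) - f q.1‖ₑ ^ 2 :=
    (((hfm.comp (measurable_fst.sub measurable_snd)).sub
      (hfm.comp measurable_fst)).enorm.pow_const 2)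
  -- Jensen's inequality for the probability measure `ν`.
  have hpt : ∀ x, ‖(mollify ρ f - f) x‖ₑ ^ 2 ≤ ∫⁻ t, ‖f (x - t) - f x‖ₑ ^ 2 ∂ν := by
    intro x
    have hm1 : Measurable fun t => f (x - t) - f x :=
      (hfm.comp (measurable_const.sub measurable_id)).sub measurable_const
    have e1 : (mollify ρ f - f) x = ∫ t, (f (x - t) - f x) * ρ t := by
      have hi : Integrable fun t => f (x - t) * ρ t :=
        integrable_mul (hf.comp_measurePreserving (Measure.measurePreserving_sub_left volume x)) hρ.memLp
      simp_rw [sub_mul]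
      rw [integral_sub hi (hρi.const_mul _), integral_const_mul, hρ1, Pi.sub_apply, mollify_eq,
        mul_one]
    have e2 : ‖(mollify ρ f - f) x‖ₑ ≤ eLpNorm (fun t => f (x - t) - f x) 1 ν := by
      rw [e1, eLpNorm_one_eq_lintegral_enorm, hν,
        lintegral_withDensity_eq_lintegral_mul _ hρm hm1.enorm]
      refine (enorm_integral_le_lintegral_enorm _).trans (lintegral_mono fun t => ?_)
      simp only [Pi.mul_apply]
      rw [enorm_mul, mul_comm, Real.enorm_of_nonneg (hρ0 t)]
    rw [← eLpNorm_two_sq]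
    gcongr
    exact e2.trans (eLpNorm_le_eLpNorm_of_exponent_le (by norm_num) hm1.aestronglyMeasurable)
  refine (ENNReal.pow_le_pow_left_iff two_ne_zero).1 ?_
  calc eLpNorm (mollify ρ f - f) 2 volume ^ 2 = ∫⁻ x, ‖(mollify ρ f - f) x‖ₑ ^ 2 :=
        eLpNorm_two_sq _ _
    _ ≤ ∫⁻ x, ∫⁻ t, ‖f (x - t) - f x‖ₑ ^ 2 ∂ν := lintegral_mono hpt
    _ = ∫⁻ t, (∫⁻ x, ‖f (x - t) - f x‖ₑ ^ 2) ∂ν := lintegral_lintegral_swap hmeas.aemeasurable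
    _ = ∫⁻ t, ENNReal.ofReal (ρ t) * eLpNorm ((fun x => f (x - t)) - f) 2 volume ^ 2 := by
        rw [hν, lintegral_withDensity_eq_lintegral_mul _ hρm hmeas.lintegral_prod_left']
        refine lintegral_congr fun t => ?_
        rw [eLpNorm_two_sq]
        rfl
    _ ≤ ∫⁻ t, ENNReal.ofReal (ρ t) * ε ^ 2 := by
        refine lintegral_mono fun t => ?_
        by_cases ht : ρ t = 0
        · simp [ht]
        · gcongr
          exact hε t ht
    _ = ε ^ 2 := by rw [lintegral_mul_const _ hρm, hmass, one_mul]

lemma eLpNorm_mollify_sub_le {ρ f : Plane → ℝ} (hρ : IsTest Set.univ ρ)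
    (hρ0 : ∀ x, 0 ≤ ρ x) (hρ1 : ∫ x, ρ x = 1) (hf : MemLp f 2 volume) {ε : ENNReal}
    (hε : ∀ a, ρ a ≠ 0 → eLpNorm ((fun x => f (x - a)) - f) 2 volume ≤ ε) :
    eLpNorm (mollify ρ f - f) 2 volume ≤ ε := by
  set f' := hf.1.mk f
  have hff' : f =ᵐ[volume] f' := hf.1.ae_eq_mk
  have e : mollify ρ f = mollify ρ f' := by
    ext x
    refine integral_congr_ae ?_
    filter_upwards [hff'] with t ht
    rw [ht]
  rw [e, eLpNorm_congr_ae (EventuallyEq.rfl.sub hff')]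
  refine eLpNorm_mollify_sub_le_of_measurable hρ hρ0 hρ1 (hf.ae_eq hff')
    hf.1.stronglyMeasurable_mk.measurable fun a ha => ?_
  have h := EventuallyEq.sub
    ((measurePreserving_sub_right volume a).quasiMeasurePreserving.ae_eq_comp hff') hff'
  exact (eLpNorm_congr_ae h).symm.trans_le (hε a ha)

/-- Kernels concentrating at the origin are approximate identities in `L²`. They need not be
centred at the origin. -/
lemma tendsto_eLpNorm_mollify_sub {ρ : ℕ → Plane → ℝ} (hρ : ∀ k, IsTest Set.univ (ρ k))
    (hρ0 : ∀ k x, 0 ≤ ρ k x) (hρ1 : ∀ k, ∫ x, ρ k x = 1) {r : ℕ → ℝ}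
    (hr : Tendsto r atTop (𝓝 0)) (hρr : ∀ k x, ρ k x ≠ 0 → ‖x‖ ≤ r k) {f : Plane → ℝ}
    (hf : MemLp f 2 volume) :
    Tendsto (fun k => eLpNorm (mollify (ρ k) f - f) 2 volume) atTop (𝓝 0) := by
  rw [ENNReal.tendsto_nhds_zero]
  intro ε hε
  have h1 := (ENNReal.tendsto_nhds_zero.1 (tendsto_eLpNorm_translate hf)) ε hε
  obtain ⟨δ, hδ, hδ'⟩ := Metric.eventually_nhds_iff.1 h1
  filter_upwards [hr.eventually_lt_const hδ] with k hk
  exact eLpNorm_mollify_sub_le (hρ k) (hρ0 k) (hρ1 k) hf fun a ha =>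
    hδ' (by rw [dist_zero_right]; exact (hρr k a ha).trans_lt hk)

/-! ### Operations on `H²` and `H²₀` -/

section Operations

variable {U : Set Plane} {u v : Plane → ℝ} {i : Fin 2}

lemma IsWeakPartial.add {f₁ f₂ g₁ g₂ : Plane → ℝ} (h₁ : IsWeakPartial U i f₁ g₁)
    (h₂ : IsWeakPartial U i f₂ g₂) (hf₁ : MemLp f₁ 2 (volume.restrict U))
    (hf₂ : MemLp f₂ 2 (volume.restrict U)) (hg₁ : MemLp g₁ 2 (volume.restrict U))
    (hg₂ : MemLp g₂ 2 (volume.restrict U)) : IsWeakPartial U i (f₁ + f₂) (g₁ + g₂) := by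
  intro φ hφ
  have ht : MemLp (partialD i φ) 2 (volume.restrict U) := (hφ.fderiv_apply _).memLp.restrict U
  have hs : MemLp φ 2 (volume.restrict U) := hφ.memLp.restrict U
  have i1 : Integrable (fun x => f₁ x * partialD i φ x) (volume.restrict U) := hf₁.integrable_mul ht
  have i2 : Integrable (fun x => f₂ x * partialD i φ x) (volume.restrict U) := hf₂.integrable_mul ht
  have i3 : Integrable (fun x => g₁ x * φ x) (volume.restrict U) := hg₁.integrable_mul hs
  have i4 : Integrable (fun x => g₂ x * φ x) (volume.restrict U) := hg₂.integrable_mul hs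
  simp_rw [Pi.add_apply, add_mul]
  rw [integral_add i1 i2, integral_add i3 i4, h₁ φ hφ, h₂ φ hφ]
  ring

lemma IsH2.add {g g' : Fin 2 → Plane → ℝ} {h h' : Fin 2 → Fin 2 → Plane → ℝ}
    (hu : IsH2 U u g h) (hv : IsH2 U v g' h') :
    IsH2 U (u + v) (fun i => g i + g' i) (fun i j => h i j + h' i j) :=
  ⟨hu.1.add hv.1, fun i => ⟨(hu.2.1 i).1.add (hv.2.1 i).1,
    (hu.2.1 i).2.add (hv.2.1 i).2 hu.1 hv.1 (hu.2.1 i).1 (hv.2.1 i).1⟩,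
    fun i j => ⟨(hu.2.2 i j).1.add (hv.2.2 i j).1,
    (hu.2.2 i j).2.add (hv.2.2 i j).2 (hu.2.1 i).1 (hv.2.1 i).1 (hu.2.2 i j).1 (hv.2.2 i j).1⟩⟩

lemma IsWeakPartial.neg {f g : Plane → ℝ} (h : IsWeakPartial U i f g) :
    IsWeakPartial U i (-f) (-g) := by
  intro φ hφ
  simp only [Pi.neg_apply, neg_mul, integral_neg, h φ hφ]

lemma MemH2.sub (hu : MemH2 U u) (hv : MemH2 U v) : MemH2 U (u - v) := by
  obtain ⟨g, h, H⟩ := hu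
  obtain ⟨g', h', H'⟩ := hv
  have H'' : IsH2 U (-v) (fun i => -g' i) (fun i j => -h' i j) :=
    ⟨H'.1.neg, fun i => ⟨(H'.2.1 i).1.neg, (H'.2.1 i).2.neg⟩,
      fun i j => ⟨(H'.2.2 i j).1.neg, (H'.2.2 i j).2.neg⟩⟩
  rw [sub_eq_add_neg]
  exact ⟨_, _, H.add H''⟩

lemma tendsto_eLpNorm_add_sub {μ : Measure Plane} {f₁ f₂ : ℕ → Plane → ℝ} {g₁ g₂ : Plane → ℝ}
    (hf₁ : ∀ k, AEStronglyMeasurable (f₁ k) μ) (hf₂ : ∀ k, AEStronglyMeasurable (f₂ k) μ)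
    (hg₁ : AEStronglyMeasurable g₁ μ) (hg₂ : AEStronglyMeasurable g₂ μ)
    (h₁ : Tendsto (fun k => eLpNorm (f₁ k - g₁) 2 μ) atTop (𝓝 0))
    (h₂ : Tendsto (fun k => eLpNorm (f₂ k - g₂) 2 μ) atTop (𝓝 0)) :
    Tendsto (fun k => eLpNorm (f₁ k + f₂ k - (g₁ + g₂)) 2 μ) atTop (𝓝 0) := by
  have h := h₁.add h₂
  rw [add_zero] at h
  refine tendsto_of_tendsto_of_tendsto_of_le_of_le tendsto_const_nhds h (fun _ => zero_le)
    fun k => ?_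
  simp only []
  rw [add_sub_add_comm]
  exact eLpNorm_add_le ((hf₁ k).sub hg₁) ((hf₂ k).sub hg₂) (by norm_num)

lemma IsTest.add {φ ψ : Plane → ℝ} (hφ : IsTest U φ) (hψ : IsTest U ψ) : IsTest U (φ + ψ) :=
  ⟨hφ.1.add hψ.1, hφ.2.1.add hψ.2.1,
    (tsupport_add φ ψ).trans (Set.union_subset hφ.2.2 hψ.2.2)⟩

lemma IsTest.partialD {φ : Plane → ℝ} (hφ : IsTest U φ) (i : Fin 2) :
    IsTest U (partialD i φ) := hφ.fderiv_apply _

lemma partialD_add {φ ψ : Plane → ℝ} (hφ : IsTest U φ) (hψ : IsTest U ψ) (i : Fin 2) :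
    partialD i (φ + ψ) = partialD i φ + partialD i ψ := by
  ext x
  have h1 : DifferentiableAt ℝ φ x := hφ.1.differentiable (by simp) x
  have h2 : DifferentiableAt ℝ ψ x := hψ.1.differentiable (by simp) x
  simp [Graphene.partialD, fderiv_add h1 h2]

lemma MemH20.add (hu : MemH20 U u) (hv : MemH20 U v) : MemH20 U (u + v) := by
  obtain ⟨g, h, H, φ, hφ, hφ0, hφ1, hφ2⟩ := hu
  obtain ⟨g', h', H', ψ, hψ, hψ0, hψ1, hψ2⟩ := hv
  refine ⟨_, _, H.add H', fun k => φ k + ψ k, fun k => (hφ k).add (hψ k), ?_, fun i => ?_,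
    fun i j => ?_⟩
  · exact tendsto_eLpNorm_add_sub (fun k => ((hφ k).memLp.restrict U).1)
      (fun k => ((hψ k).memLp.restrict U).1) H.1.1 H'.1.1 hφ0 hψ0
  · simp_rw [fun k => partialD_add (hφ k) (hψ k) i]
    exact tendsto_eLpNorm_add_sub (fun k => (((hφ k).partialD i).memLp.restrict U).1)
      (fun k => (((hψ k).partialD i).memLp.restrict U).1) (H.2.1 i).1.1 (H'.2.1 i).1.1
      (hφ1 i) (hψ1 i)
  · simp_rw [fun k => partialD_add (hφ k) (hψ k) i,
      fun k => partialD_add ((hφ k).partialD i) ((hψ k).partialD i) j]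
    exact tendsto_eLpNorm_add_sub (fun k => ((((hφ k).partialD i).partialD j).memLp.restrict U).1)
      (fun k => ((((hψ k).partialD i).partialD j).memLp.restrict U).1) (H.2.2 i j).1.1
      (H'.2.2 i j).1.1 (hφ2 i j) (hψ2 i j)

lemma memH20_of_ae_eq_zero (hu : u =ᵐ[volume.restrict U] 0) : MemH20 U u := by
  have h0 : MemLp (0 : Plane → ℝ) 2 (volume.restrict U) := MemLp.zero
  have hw : ∀ (i : Fin 2) (f : Plane → ℝ), f =ᵐ[volume.restrict U] 0 → IsWeakPartial U i f 0 := by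
    intro i f hf φ _
    have : ∫ x in U, f x * partialD i φ x = ∫ x in U, (0 : ℝ) :=
      integral_congr_ae (hf.mono fun x hx => by simp [hx])
    simp [this]
  have hp : ∀ i : Fin 2, partialD i (0 : Plane → ℝ) = 0 := by
    intro i; ext x; simp [Graphene.partialD]
  refine ⟨fun _ => 0, fun _ _ => 0, ⟨(memLp_congr_ae hu).2 h0, fun i => ⟨h0, hw i u hu⟩,
    fun i j => ⟨h0, hw j 0 .rfl⟩⟩, fun _ => 0, fun _ => ⟨contDiff_const, .zero, by simp⟩, ?_, ?_, ?_⟩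
  · have : eLpNorm (0 - u) 2 (volume.restrict U) = 0 := by
      rw [zero_sub, eLpNorm_neg, eLpNorm_congr_ae hu, eLpNorm_zero]
    simp only [this, tendsto_const_nhds]
  · simp [hp]
  · simp [hp]

lemma memLp_test_mul {η f : Plane → ℝ} (hη : IsTest Set.univ η) (hf : MemLp f 2 volume) :
    MemLp (η * f) 2 volume :=
  hf.mul (hη.1.continuous.memLp_top_of_hasCompactSupport hη.2.1 volume)

lemma partialD_mul {η φ : Plane → ℝ} (hη : IsTest Set.univ η) (hφ : IsTest Set.univ φ)
    (i : Fin 2) (x : Plane) :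
    partialD i (η * φ) x = η x * partialD i φ x + φ x * partialD i η x := by
  have h1 : DifferentiableAt ℝ η x := hη.1.differentiable (by simp) x
  have h2 : DifferentiableAt ℝ φ x := hφ.1.differentiable (by simp) x
  simp [Graphene.partialD, fderiv_mul h1 h2]

/-- The product rule for weak derivatives. -/
lemma IsWeakPartial.test_mul {η f g : Plane → ℝ} (hη : IsTest Set.univ η)
    (h : IsWeakPartial Set.univ i f g) (hf : MemLp f 2 volume) (hg : MemLp g 2 volume) :
    IsWeakPartial Set.univ i (η * f) (η * g + partialD i η * f) := by
  intro φ hφ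
  have hηφ : IsTest Set.univ (η * φ) :=
    ⟨hη.1.mul hφ.1, hη.2.1.mul_right, Set.subset_univ _⟩
  have h1 := h _ hηφ
  simp_rw [setIntegral_univ, partialD_mul hη hφ] at h1
  simp_rw [setIntegral_univ]
  have i1 : Integrable fun x => f x * (η x * partialD i φ x) :=
    integrable_mul hf (memLp_test_mul hη (hφ.partialD i).memLp)
  have i2 : Integrable fun x => f x * (φ x * partialD i η x) :=
    integrable_mul hf (memLp_test_mul hφ (hη.partialD i).memLp)
  have i3 : Integrable fun x => g x * (η x * φ x) := integrable_mul hg hηφ.memLp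
  have e1 : ∫ x, (η * f) x * partialD i φ x = ∫ x, f x * (η x * partialD i φ x) :=
    integral_congr_ae (.of_forall fun x => by simp only [Pi.mul_apply]; ring)
  have e2 : ∫ x, (η * g + partialD i η * f) x * φ x =
      ∫ x, (g x * (η x * φ x) + f x * (φ x * partialD i η x)) :=
    integral_congr_ae (.of_forall fun x => by simp only [Pi.mul_apply, Pi.add_apply]; ring)
  simp_rw [mul_add] at h1
  rw [integral_add i1 i2] at h1
  rw [e1, e2, integral_add i3 i2]
  simp only [Pi.mul_apply] at h1
  linarith

lemma MemH2.test_mul {η : Plane → ℝ} (hη : IsTest Set.univ η) (hu : MemH2 Set.univ u) :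
    MemH2 Set.univ (η * u) := by
  obtain ⟨g, h, H0, H1, H2⟩ := hu
  simp only [Measure.restrict_univ] at H0 H1 H2
  refine ⟨fun i => η * g i + partialD i η * u, fun i j => (η * h i j + partialD j η * g i) +
    (partialD i η * g j + partialD j (partialD i η) * u), ?_⟩
  have hη1 := fun i => hη.partialD i
  have hη2 := fun i j => (hη1 i).partialD j
  have m1 : ∀ i j, MemLp (η * h i j + partialD j η * g i) 2 volume := fun i j =>
    (memLp_test_mul hη (H2 i j).1).add (memLp_test_mul (hη1 j) (H1 i).1)
  have m2 : ∀ i j, MemLp (partialD i η * g j + partialD j (partialD i η) * u) 2 volume :=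
    fun i j => (memLp_test_mul (hη1 i) (H1 j).1).add (memLp_test_mul (hη2 i j) H0)
  refine ⟨?_, fun i => ⟨?_, (H1 i).2.test_mul hη H0 (H1 i).1⟩, fun i j => ⟨?_, ?_⟩⟩
  · rw [Measure.restrict_univ]; exact memLp_test_mul hη H0
  · rw [Measure.restrict_univ]
    exact (memLp_test_mul hη (H1 i).1).add (memLp_test_mul (hη1 i) H0)
  · rw [Measure.restrict_univ]; exact (m1 i j).add (m2 i j)
  · refine ((H2 i j).2.test_mul hη (H1 i).1 (H2 i j).1).add
      ((H1 j).2.test_mul (hη1 i) H0 (H1 j).1) ?_ ?_ ?_ ?_ <;> rw [Measure.restrict_univ]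
    exacts [memLp_test_mul hη (H1 i).1, memLp_test_mul (hη1 i) H0, m1 i j, m2 i j]

lemma IsWeakPartial.restrict {f g : Plane → ℝ} (h : IsWeakPartial Set.univ i f g) (U : Set Plane) :
    IsWeakPartial U i f g := by
  intro φ hφ
  have h1 := h φ hφ.univ
  rw [setIntegral_univ, setIntegral_univ] at h1
  rw [setIntegral_eq_integral_of_forall_compl_eq_zero,
    setIntegral_eq_integral_of_forall_compl_eq_zero, h1]
  · intro x hx
    rw [image_eq_zero_of_notMem_tsupport fun h => hx (hφ.2.2 h), mul_zero]
  · intro x hx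
    rw [image_eq_zero_of_notMem_tsupport fun h => hx ((hφ.partialD i).2.2 h), mul_zero]

lemma IsH2.restrict {g : Fin 2 → Plane → ℝ} {h : Fin 2 → Fin 2 → Plane → ℝ}
    (H : IsH2 Set.univ u g h) (U : Set Plane) : IsH2 U u g h := by
  obtain ⟨H0, H1, H2⟩ := H
  rw [Measure.restrict_univ] at H0 H1 H2
  exact ⟨H0.restrict U, fun i => ⟨(H1 i).1.restrict U, (H1 i).2.restrict U⟩,
    fun i j => ⟨(H2 i j).1.restrict U, (H2 i j).2.restrict U⟩⟩

end Operations

/-! ### `H²₀` and the segment property -/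

/-- A compactly supported `H²` function whose support can be pushed into `Ω` by short translations
in one direction is in `H²₀(Ω)`: mollify it with kernels centred at `t y`. -/
lemma memH20_of_translate {Ω : Set Plane} (hΩ : IsOpen Ω) {u : Plane → ℝ}
    (hu : MemH2 Set.univ u) {A : Set Plane} (hA : IsCompact A) (huA : ∀ᵐ x, x ∉ A → u x = 0)
    {y : Plane} (hy : ∀ z ∈ A, ∀ t : ℝ, 0 < t → t < 1 → z + t • y ∈ Ω) : MemH20 Ω u := by
  obtain ⟨g, h, H⟩ := hu
  have HΩ := H.restrict Ω
  obtain ⟨H0, H1, H2⟩ := H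
  rw [Measure.restrict_univ] at H0 H1 H2
  -- The translation lengths, which have to stay in `(0, 1)`.
  set t : ℕ → ℝ := fun k => 1 / ((k : ℝ) + 1 + 1) with ht
  have ht0 : ∀ k, 0 < t k := fun k => by positivity
  have ht1 : ∀ k, t k < 1 := fun k => by
    rw [ht]; simp only; rw [div_lt_one (by positivity)]
    linarith [(k.cast_nonneg : (0 : ℝ) ≤ k)]
  have htlim : Tendsto t atTop (𝓝 0) := by
    have := (tendsto_add_atTop_iff_nat 1).2 (tendsto_one_div_add_atTop_nhds_zero_nat (𝕜 := ℝ))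
    simpa [ht] using this
  have hδ : ∀ k, ∃ δ, 0 < δ ∧
      Metric.cthickening δ ((fun z => z + t k • y) '' A) ⊆ Ω := fun k =>
    (hA.image (by fun_prop)).exists_cthickening_subset_open hΩ
      (Set.image_subset_iff.2 fun z hz => hy z hz (t k) (ht0 k) (ht1 k))
  choose δ hδ0 hδΩ using hδ
  set r : ℕ → ℝ := fun k => min (δ k) (t k) with hr
  have hr0 : ∀ k, 0 < r k := fun k => lt_min (hδ0 k) (ht0 k)
  set b : ∀ k, ContDiffBump (t k • y) := fun k => ⟨r k / 2, r k, half_pos (hr0 k),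
    half_lt_self (hr0 k)⟩
  set ρ : ℕ → Plane → ℝ := fun k => (b k).normed volume with hρdef
  have hρ : ∀ k, IsTest Set.univ (ρ k) := fun k =>
    ⟨(b k).contDiff_normed, (b k).hasCompactSupport_normed, Set.subset_univ _⟩
  have hρ0 : ∀ k x, 0 ≤ ρ k x := fun k x => (b k).nonneg_normed x
  have hρ1 : ∀ k, ∫ x, ρ k x = 1 := fun k => (b k).integral_normed
  have hρs : ∀ k x, ρ k x ≠ 0 → dist x (t k • y) < r k := fun k x hx => by
    have : x ∈ Function.support ((b k).normed volume) := hx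
    rw [(b k).support_normed_eq] at this
    exact this
  have hρr : ∀ k x, ρ k x ≠ 0 → ‖x‖ ≤ t k * (‖y‖ + 1) := fun k x hx => by
    have h1 := hρs k x hx
    rw [dist_eq_norm] at h1
    have h2 : ‖x‖ ≤ ‖x - t k • y‖ + ‖t k • y‖ := by
      simpa using norm_add_le (x - t k • y) (t k • y)
    rw [norm_smul, Real.norm_of_nonneg (ht0 k).le] at h2
    have h3 : r k ≤ t k := min_le_right _ _
    linarith
  have hlim : Tendsto (fun k => t k * (‖y‖ + 1)) atTop (𝓝 0) := by
    simpa using htlim.mul_const (‖y‖ + 1)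
  have hconv : ∀ f, MemLp f 2 volume →
      Tendsto (fun k => eLpNorm (mollify (ρ k) f - f) 2 (volume.restrict Ω)) atTop (𝓝 0) :=
    fun f hf => tendsto_of_tendsto_of_tendsto_of_le_of_le tendsto_const_nhds
      (tendsto_eLpNorm_mollify_sub hρ hρ0 hρ1 hlim hρr hf) (fun _ => zero_le)
      fun k => eLpNorm_mono_measure _ Measure.restrict_le_self
  have hD1 : ∀ k i, partialD i (mollify (ρ k) u) = mollify (ρ k) (g i) := fun k i =>
    partialD_mollify (hρ k) H0 (H1 i).2
  have hD2 : ∀ k i j, partialD j (mollify (ρ k) (g i)) = mollify (ρ k) (h i j) := fun k i j =>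
    partialD_mollify (hρ k) (H1 i).1 (H2 i j).2
  refine ⟨g, h, HΩ, fun k => mollify (ρ k) u, fun k => ?_, hconv u H0, fun i => ?_, fun i j => ?_⟩
  · set T := Metric.cthickening (δ k) ((fun z => z + t k • y) '' A) with hT
    have hTc : IsCompact T := (hA.image (by fun_prop)).cthickening
    have hsupp : Function.support (mollify (ρ k) u) ⊆ T := by
      intro x hx
      by_contra hxT
      refine hx ?_
      have h0 : (fun s => u s * ρ k (x - s)) =ᵐ[volume] 0 := by
        filter_upwards [huA] with s hs
        by_cases hsA : s ∈ A
        · have : ρ k (x - s) = 0 := by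
            by_contra hne
            refine hxT (Metric.mem_cthickening_of_dist_le x (s + t k • y) _ _ ⟨s, hsA, rfl⟩ ?_)
            have h4 := (hρs k _ hne).le.trans (min_le_left _ _)
            rwa [dist_eq_norm, sub_sub, ← dist_eq_norm] at h4
          simp [this]
        · simp [hs hsA]
      rw [mollify, integral_congr_ae h0]
      simp
    have hts : tsupport (mollify (ρ k) u) ⊆ T := closure_minimal hsupp hTc.isClosed
    exact ⟨contDiff_mollify (hρ k) H0, hTc.of_isClosed_subset (isClosed_tsupport _) hts,
      hts.trans (hδΩ k)⟩
  · simp_rw [hD1]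
    exact hconv _ (H1 i).1
  · simp_rw [hD1, hD2]
    exact hconv _ (H2 i j).1

/-- The localization: a function covered by finitely many balls as in `memH20_of_translate` is
split by multiplication with bump functions, one ball at a time. -/
lemma memH20_of_cover {Ω : Set Plane} (hΩ : IsOpen Ω) (hΩb : Bornology.IsBounded Ω)
    {r : Plane → ℝ} {y : Plane → Plane} (s : Finset Plane) (hr : ∀ x ∈ s, 0 < r x)
    (hy : ∀ x ∈ s, ∀ z ∈ closure Ω ∩ Metric.closedBall x (2 * r x), ∀ t : ℝ, 0 < t → t < 1 →
      z + t • y x ∈ Ω) (u : Plane → ℝ) (hu : MemH2 Set.univ u) (huΩ : ∀ᵐ x, x ∉ Ω → u x = 0)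
    (hus : ∀ᵐ z, (∀ x ∈ s, z ∉ Metric.closedBall x (r x)) → u z = 0) : MemH20 Ω u := by
  classical
  induction s using Finset.induction_on generalizing u with
  | empty => exact memH20_of_ae_eq_zero (ae_restrict_of_ae (hus.mono fun x hx => hx (by simp)))
  | insert a s ha ih =>
    have hra := hr a (Finset.mem_insert_self a s)
    set b : ContDiffBump a := ⟨r a, 2 * r a, hra, by linarith⟩ with hb
    have hbt : IsTest Set.univ b := ⟨b.contDiff, b.hasCompactSupport, Set.subset_univ _⟩
    have hbu : MemH2 Set.univ ((b : Plane → ℝ) * u) := hu.test_mul hbt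
    have e : u = (b : Plane → ℝ) * u + (u - (b : Plane → ℝ) * u) := by abel
    rw [e]
    refine MemH20.add ?_ ?_
    · refine memH20_of_translate hΩ hbu
        (hΩb.isCompact_closure.inter_right (Metric.isClosed_closedBall (x := a) (ε := 2 * r a)))
        ?_ (hy a (Finset.mem_insert_self a s))
      filter_upwards [huΩ] with x hx hxA
      rw [Pi.mul_apply]
      by_cases hxΩ : x ∈ Ω
      · have : x ∉ tsupport b := by
          rw [b.tsupport_eq]
          exact fun h => hxA ⟨subset_closure hxΩ, h⟩
        rw [image_eq_zero_of_notMem_tsupport this, zero_mul]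
      · rw [hx hxΩ, mul_zero]
    · refine ih (fun x hx => hr x (Finset.mem_insert_of_mem hx))
        (fun x hx => hy x (Finset.mem_insert_of_mem hx)) _ (hu.sub hbu) ?_ ?_
      · filter_upwards [huΩ] with x hx hxΩ
        simp [hx hxΩ]
      · filter_upwards [hus] with z hz hzs
        by_cases hza : z ∈ Metric.closedBall a (r a)
        · have : b z = 1 := b.one_of_mem_closedBall hza
          simp [this]
        · have : u z = 0 := hz fun x hx => by
            rcases Finset.mem_insert.1 hx with rfl | hx
            exacts [hza, hzs x hx]
          simp [this]

/-- An `H²(ℝ²)` function vanishing outside a bounded open set with the segment property is in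
`H²₀` of that set. -/
lemma memH20_of_segmentProperty {Ω : Set Plane} (hΩ : IsOpen Ω) (hΩb : Bornology.IsBounded Ω)
    (hseg : SegmentProperty Ω) {u : Plane → ℝ} (hu : MemH2 Set.univ u)
    (huΩ : ∀ᵐ x, x ∉ Ω → u x = 0) : MemH20 Ω u := by
  -- In the interior the zero direction does.
  have hloc : ∀ x ∈ closure Ω, ∃ (r : ℝ) (y : Plane), 0 < r ∧
      ∀ z ∈ closure Ω ∩ Metric.closedBall x (2 * r), ∀ t : ℝ, 0 < t → t < 1 →
        z + t • y ∈ Ω := by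
    have shrink : ∀ (x : Plane), ∀ V ∈ 𝓝 x, ∃ r > 0, Metric.closedBall x (2 * r) ⊆ V := by
      intro x V hV
      obtain ⟨ε, hε, h⟩ := Metric.nhds_basis_closedBall.mem_iff.1 hV
      exact ⟨ε / 2, half_pos hε, by rwa [mul_div_cancel₀ _ two_ne_zero]⟩
    intro x hx
    by_cases hxΩ : x ∈ Ω
    · obtain ⟨r, hr, h⟩ := shrink x Ω (hΩ.mem_nhds hxΩ)
      exact ⟨r, 0, hr, fun z hz t _ _ => by simpa using h hz.2⟩
    · obtain ⟨V, hV, y, -, hy⟩ := hseg x ⟨hx, by rwa [hΩ.interior_eq]⟩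
      obtain ⟨r, hr, h⟩ := shrink x V hV
      exact ⟨r, y, hr, fun z hz => hy z ⟨hz.1, h hz.2⟩⟩
  choose! r y hr hy using hloc
  obtain ⟨s, hs, hcov⟩ := hΩb.isCompact_closure.elim_nhds_subcover
    (fun x => Metric.closedBall x (r x)) fun x hx => Metric.closedBall_mem_nhds x (hr x hx)
  refine memH20_of_cover hΩ hΩb s (fun x hx => hr x (hs x hx)) (fun x hx => hy x (hs x hx)) u hu
    huΩ ?_
  filter_upwards [huΩ] with z hz hzs
  refine hz fun hzΩ => ?_
  obtain ⟨x, hx, hzx⟩ := Set.mem_iUnion₂.1 (hcov (subset_closure hzΩ))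
  exact hzs x hx hzx

lemma ae_eq_zero_of_tendsto {Ω : Set Plane} {w : ℕ → Plane → ℝ} {g : Plane → ℝ}
    (hΩ : MeasurableSet Ω) (hw : ∀ k, ∀ᵐ x, x ∉ Ω → w k x = 0) (hg : AEStronglyMeasurable g volume)
    (h : Tendsto (fun k => eLpNorm (w k - g) 2 volume) atTop (𝓝 0)) :
    ∀ᵐ x, x ∉ Ω → g x = 0 := by
  have h1 : ∀ k, eLpNorm g 2 (volume.restrict Ωᶜ) ≤ eLpNorm (w k - g) 2 volume := fun k => by
    -- Outside `Ω` the difference `w k - g` is `-g`.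
    refine le_trans (le_of_eq ?_)
      (eLpNorm_mono_measure (w k - g) (Measure.restrict_le_self (s := Ωᶜ)))
    rw [← eLpNorm_neg]
    refine eLpNorm_congr_ae ?_
    filter_upwards [(ae_restrict_iff' hΩ.compl).2 (hw k)] with x hx
    simp [hx]
  have h2 : eLpNorm g 2 (volume.restrict Ωᶜ) = 0 :=
    le_antisymm (ge_of_tendsto' h h1) zero_le
  rw [eLpNorm_eq_zero_iff hg.restrict two_ne_zero] at h2
  exact (ae_restrict_iff' hΩ.compl).1 h2

end Graphene

end

theorem theorem1 (Ω : Set Graphene.Plane) (hΩ_open : IsOpen Ω)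
    (hΩ_bdd : Bornology.IsBounded Ω) (hΩ_sc : IsSimplyConnected Ω)
    (kZ kC τ₀ : ℝ) (hkZ : 0 < kZ) (hkC : 0 ≤ kC) (hτ₀ : τ₀ ≤ 0)
    (ℓ : ℕ → ℝ) (hℓ_pos : ∀ n, 0 < ℓ n) (hℓ_lim : Tendsto ℓ atTop (𝓝 0))
    (w : ℕ → Graphene.Plane → ℝ) (hw : ∀ n, w n ∈ Graphene.Admissible Ω (ℓ n))
    (hbound : BddAbove (Set.range fun n => Graphene.energy kZ kC τ₀ (ℓ n) (w n))) :
    ∃ (w₀ : Graphene.Plane → ℝ) (σ : ℕ → ℕ),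
      (Graphene.MemH2 Set.univ w₀ ∧ ∀ᵐ x, x ∉ Ω → w₀ x = 0) ∧
      (Graphene.SegmentProperty Ω → Graphene.MemH20 Ω w₀) ∧
      StrictMono σ ∧
      Tendsto (fun k => eLpNorm (w (σ k) - w₀) 2 (volume.restrict Ω)) atTop (𝓝 0) := by
  obtain ⟨R, hR⟩ := hΩ_bdd.exists_norm_le
  obtain ⟨L, hL⟩ := hℓ_lim.bddAbove_range
  obtain ⟨M, hM⟩ := hbound
  obtain ⟨C, hC0, hC⟩ := Graphene.exists_nodalBounds (Ω := Ω) (L := L) hkZ hkC hτ₀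
    (le_max_right R 0) (fun x hx => (hR x hx).trans (le_max_left _ _)) (le_max_right M 0)
  have hnb : ∀ k, Graphene.NodalBounds C (ℓ k) (fun n => w k (Graphene.node (ℓ k) 0 n))
      (fun n => w k (Graphene.node (ℓ k) 1 n)) := fun k =>
    hC (ℓ k) (hℓ_pos k) (hL ⟨k, rfl⟩) (w k) (hw k) ((hM ⟨k, rfl⟩).trans (le_max_left _ _))
  obtain ⟨σ, g, hσ, hgm, hlim⟩ :=
    Graphene.exists_subseq_comp_cell_tendsto hC0 hℓ_pos hℓ_lim hnb
  -- The limit of the values over `L₁(ℓ)` is also the limit of the displacements.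
  have hℓσ := hℓ_lim.comp hσ.tendsto_atTop
  have hdiff := (Graphene.tendsto_eLpNorm_sub_comp_cell hℓ_pos hℓ_lim hw hnb).comp
    hσ.tendsto_atTop
  have hconv : Tendsto (fun k => eLpNorm (w (σ k) - g) 2 volume) atTop (𝓝 0) := by
    have h := hdiff.add hlim
    rw [add_zero] at h
    refine tendsto_of_tendsto_of_tendsto_of_le_of_le tendsto_const_nhds h (fun _ => zero_le)
      fun k => ?_
    have hm := (Graphene.measurable_comp_cell
      (fun n => w (σ k) (Graphene.node (ℓ (σ k)) 0 n)) (ℓ (σ k))).aestronglyMeasurable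
      (μ := volume)
    have h1 := eLpNorm_add_le (p := 2) ((hw (σ k)).1.1.sub hm) (hm.sub hgm.aestronglyMeasurable)
      (by norm_num)
    rwa [sub_add_sub_cancel] at h1
  have hH2 : Graphene.MemH2 Set.univ g :=
    Graphene.memH2_of_comp_cell_tendsto (fun k => hℓ_pos (σ k)) hℓσ (fun k => hnb (σ k)) hgm hlim
  have hzero : ∀ᵐ x, x ∉ Ω → g x = 0 :=
    Graphene.ae_eq_zero_of_tendsto hΩ_open.measurableSet
      (fun k => Graphene.Admissible.ae_eq_zero (hℓ_pos (σ k)) (hw (σ k)))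
      hgm.aestronglyMeasurable hconv
  exact ⟨g, σ, ⟨hH2, hzero⟩,
    fun hseg => Graphene.memH20_of_segmentProperty hΩ_open hΩ_bdd hseg hH2 hzero, hσ,
    tendsto_of_tendsto_of_tendsto_of_le_of_le tendsto_const_nhds hconv (fun _ => zero_le)
      fun k => eLpNorm_mono_measure _ Measure.restrict_le_self⟩
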